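/- Let $\theta\in\mathbb R$, and let $\log$ denote the branch of the logarithm with imaginary part in $(\theta-\pi,\theta+\pi]$; put $z^{L}=\exp(L\log z)$ for a square matrix $L$. Let $U\subset\mathbb C^n$ be an open set of points $(x_1,\dots,x_n)$ such that the cuts $x_j-e^{i\theta}[0,\infty)$ lie on pairwise distinct lines (for given distinct points $x_j$ this holds for all but finitely many directions $\theta$ modulo $\pi$), and let $D$ be the plane $\mathbb C$ without these cuts. For every $(x_1,\dots,x_n)\in U$ let $A_1,\dots,A_n$ be $N\times N$ complex matrices depending on the parameters $(x_1,\dots,x_n)$, and let $Y=Y(x)=Y(x;x_1,\dots,x_n)$ be an invertible matrix solution on $D$ of the Fuchsian system $$\frac{dY}{dx}=\sum_{k=1}^n\frac{A_k}{x-x_k}\,Y .$$ Suppose that there are matrices $L_1,\dots,L_n,L_\infty$ (the local exponent matrices), depending on the parameters, such that $$Y(x)=Y_j(x)\,(x-x_j)^{L_j}\quad\text{on } D \text{ near } x=x_j\ (j=1,\dots,n),\qquad Y(x)=Y_\infty(x)\,x^{-L_\infty}\quad\text{for } \operatorname{Re}(e^{-i\theta}x) \text{ large},$$ where, locally in the parameters,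 $Y_j$ is holomorphic in $x$ and the parameters near $x=x_j$ with $Y_j(x_j)$ invertible, and $Y_\infty$ is holomorphic in $1/x$ and the parameters near $x=\infty$ with $Y_\infty=I+O(1/x)$ (the last expansion being valid in a half plane that can be chosen locally uniformly in the parameters). Suppose that the local exponent matrices change only in their scalar part: there are scalar functions $f_{jk}$ of the parameters with $$\frac{\partial L_j}{\partial x_k}=f_{jk}\,I\qquad(j,k=1,\dots,n)$$ on $U$, and each partial derivative $\partial L_\infty/\partial x_k$ exists and is a scalar multiple of $I$. Then, on $U$ and for $k=1,\dots,n$, $$\frac{\partial L_\infty}{\partial x_k}=-\sum_{j=1}^n f_{jk}\,I ,$$ and for every $x\in D$ the partial derivative $\partial Y/\partial x_k$ exists and $$\frac{\partial Y}{\partial x_k}=\Bigl(-\frac{A_k}{x-x_k}+\sum_{j=1}^n f_{jk}\log(x-x_j)\,I\Bigr)Y .$$ -/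

import Mathlib

open scoped Topology

noncomputable section

namespace MonodromyEvolving

/-- The branch of the logarithm with imaginary part in `(θ - π, θ + π]`; it is holomorphic off the
ray `{-r e^{iθ} : r ≥ 0}`, and it is the principal branch for `θ = 0`. -/
def branchLog (θ : ℝ) (z : ℂ) : ℂ :=
  Complex.log (Complex.exp (-(θ * Complex.I)) * z) + θ * Complex.I

/-- The matrix power `z ^ L = exp (L log z)`, with the branch of `log` chosen above. -/
def matPow {N : ℕ} (θ : ℝ) (z : ℂ) (L : Matrix (Fin N) (Fin N) ℂ) : Matrix (Fin N) (Fin N) ℂ :=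
  NormedSpace.exp (branchLog θ z • L)

/-- The plane cut along the parallel rays `{a j - r e^{iθ} : r ≥ 0}` that start at the singular
points `a j`. -/
def cutPlane {n : ℕ} (θ : ℝ) (a : Fin n → ℂ) : Set ℂ :=
  {x | ∀ j, Complex.exp (-(θ * Complex.I)) * (x - a j) ∈ Complex.slitPlane}

/-- The cuts from the points `a j` in the direction `-e^{iθ}` lie on pairwise distinct lines.  In
particular the points are pairwise distinct.  For given distinct points this holds for all but
finitely many directions. -/
def CutsDisjoint {n : ℕ} (θ : ℝ) (a : Fin n → ℂ) : Prop :=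
  ∀ i j, i ≠ j → (Complex.exp (-(θ * Complex.I)) * (a i - a j)).im ≠ 0

/-- `Y` is a fundamental matrix solution, on the cut plane, of the Fuchsian system
`dY/dx = (∑ k, A k / (x - a k)) Y`. -/
structure IsFundamentalSolution {n N : ℕ} (θ : ℝ) (a : Fin n → ℂ)
    (A : Fin n → Matrix (Fin N) (Fin N) ℂ) (Y : ℂ → Matrix (Fin N) (Fin N) ℂ) : Prop where
  hasDerivAt : ∀ x ∈ cutPlane θ a,
    HasDerivAt Y ((∑ k, (x - a k)⁻¹ • A k) * Y x) x
  isUnit : ∀ x ∈ cutPlane θ a, IsUnit (Y x)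

/-- Near the singular point `a j`, and for parameters near `a`,
`Y (b, x) = G (b, x) (x - b j) ^ L b`, where `G` is holomorphic in `(b, x)` and invertible at
`x = a j`.  The matrix `L b` need not be in a normal form, so that a constant right factor
(connection matrix) `C` is included: `(x - b j) ^ L * C = C * (x - b j) ^ (C⁻¹ * L * C)`. -/
def HasLocalExpansionAt {n N : ℕ} (θ : ℝ) (Y : (Fin n → ℂ) → ℂ → Matrix (Fin N) (Fin N) ℂ)
    (j : Fin n) (L : (Fin n → ℂ) → Matrix (Fin N) (Fin N) ℂ) (a : Fin n → ℂ) : Prop :=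
  ∃ G : (Fin n → ℂ) × ℂ → Matrix (Fin N) (Fin N) ℂ,
    (∀ p q, AnalyticAt ℂ (fun z => G z p q) (a, a j)) ∧
    IsUnit (G (a, a j)) ∧
    ∀ᶠ z in 𝓝 (a, a j), z.2 ∈ cutPlane θ z.1 →
      Y z.1 z.2 = G z * matPow θ (z.2 - z.1 j) (L z.1)

/-- Near `x = ∞`, and for parameters near `a`, `Y (b, x) = H (b, 1 / x) x ^ (-Linf b)`, where
`H (b, w)` is holomorphic near `(a, 0)` and `H (b, 0) = 1`, that is, `H (b, 1 / x) = I + O(1 / x)`.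
The equation is required in a half plane that does not meet the cuts. -/
def HasExpansionAtInfty {n N : ℕ} (θ : ℝ) (Y : (Fin n → ℂ) → ℂ → Matrix (Fin N) (Fin N) ℂ)
    (Linf : (Fin n → ℂ) → Matrix (Fin N) (Fin N) ℂ) (a : Fin n → ℂ) : Prop :=
  ∃ H : (Fin n → ℂ) × ℂ → Matrix (Fin N) (Fin N) ℂ,
    (∀ p q, AnalyticAt ℂ (fun z => H z p q) (a, 0)) ∧
    (∀ᶠ b in 𝓝 a, H (b, 0) = 1) ∧
    ∃ R : ℝ, ∀ᶠ b in 𝓝 a, ∀ x : ℂ, R < (Complex.exp (-(θ * Complex.I)) * x).re →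
      Y b x = H (b, x⁻¹) * matPow θ x (-Linf b)

/-- The partial derivative of `F` with respect to the `k`-th parameter exists at `a` and is `F'`. -/
def HasPartialDerivAt {n N : ℕ} (k : Fin n) (F : (Fin n → ℂ) → Matrix (Fin N) (Fin N) ℂ)
    (F' : Matrix (Fin N) (Fin N) ℂ) (a : Fin n → ℂ) : Prop :=
  HasDerivAt (fun s : ℂ => F (Function.update a k s)) F' (a k)

end MonodromyEvolving

end

/-!
The proof treats one parameter `x_k` at a time and compares `(∂Y/∂x_k) Y⁻¹` with its expected value
`-A_k / (x - x_k) + ∑ j, f_jk log (x - x_j)`.  The difference `E`, called `defect` below, is shown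
to vanish by Liouville's theorem.

* *Existence of `∂Y/∂x_k`.*  The residues `A_j` are conjugate to the exponents by the leading
  coefficients of the local expansions (`residue_mul_eq`), so they are differentiable in the
  parameters.  On a half plane `∂Y/∂x_k` exists by the expansion at infinity.  Every point of the cut
  plane is joined to that half plane by a ray parallel to the cuts; differentiability is carried
  along the ray by a Grönwall estimate, which also yields the variational equation
  (`hasDerivAt_param_of_linearODE`, `IsScalarDeformation.exists_variation`).
* *`E` is entire.*  Since the exponents change by scalars only, differentiating the local expansion
  at `x_j` gives a holomorphic term, a term `f_jk log (x - x_j)`, and a simple pole for `j = k`.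
  The logarithm and, by the conjugacy of `A_k` to `L_k`, the pole cancel in `E`, so `E` continues
  to a neighbourhood of `x_j` (`IsScalarDeformation.exists_defect_continuation_at_pole`).  By the
  variational equation `E` solves a linear equation with rational coefficients that have no poles
  off the points `x_j`, so the continuation propagates along the whole cut
  (`exists_continuation_across_cut`).
* *`E = 0`.*  In the half plane, `E` is holomorphic in `1/x` up to a combination of logarithms, so
  the entire function `x E'(x)` is holomorphic in `1/x` there, hence around all of `∞`; it is therefore
  constant, equal to its value `0` at `x = 0`.  Its value at infinity is the coefficient of `log x`
  in `E`, which gives the relation for `∂L_∞/∂x_k`; and `E` is constant, with limit `0` along a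
  ray (`IsScalarDeformation.smul_one_eq_and_defect_eq_zero`).

The argument works in any complex Banach algebra and for an arbitrary differentiable
curve `s ↦ (x_1(s), …, x_n(s))` of parameters; it is stated in that form (`IsScalarDeformation`) and
then applied to matrices and coordinate lines.
-/

/-! ### Linear differential equations in a convex domain -/

namespace MonodromyEvolving

open Set Filter Asymptotics

section LinearODE

lemma isCompact_segment {E : Type*} [AddCommGroup E] [TopologicalSpace E] [IsTopologicalAddGroup E]
    [Module ℝ E] [ContinuousSMul ℝ E] (x y : E) : IsCompact (segment ℝ x y) := by
  rw [segment_eq_image_lineMap]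
  exact isCompact_Icc.image (by fun_prop)

variable {E : Type*} [NormedAddCommGroup E] [NormedSpace ℂ E]

lemma segmentParam_mem {Ω : Set ℂ} (hc : Convex ℝ Ω) {x₀ x : ℂ} (hx₀ : x₀ ∈ Ω) (hx : x ∈ Ω)
    {t : ℝ} (ht : t ∈ Icc (0 : ℝ) 1) : x₀ + t * (x - x₀) ∈ Ω := by
  simpa using hc.add_smul_sub_mem hx₀ hx ht

lemma hasDerivAt_comp_segmentParam {u : ℂ → E} {u' : E} {x₀ x : ℂ} {t : ℝ}
    (h : HasDerivAt u u' (x₀ + t * (x - x₀))) :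
    HasDerivAt (fun t : ℝ => u (x₀ + t * (x - x₀))) ((x - x₀) • u') t := by
  have h1 : HasDerivAt (fun t : ℝ => x₀ + (t : ℂ) * (x - x₀)) (x - x₀) t := by
    simpa using ((Complex.ofRealCLM.hasDerivAt (x := t)).mul_const (x - x₀)).const_add x₀
  exact HasDerivAt.scomp t h h1

/-- A holomorphic function on a convex open set has a primitive. -/
lemma exists_primitive_of_convex [CompleteSpace E] {Ω : Set ℂ} (ho : IsOpen Ω) (hc : Convex ℝ Ω)
    {f : ℂ → E} (hf : DifferentiableOn ℂ f Ω) :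
    ∃ F : ℂ → E, ∀ x ∈ Ω, HasDerivAt F (f x) x := by
  let e := ContinuousLinearMap.smulRightL ℂ ℂ E (1 : ℂ →L[ℂ] ℂ)
  have hω : ∀ x ∈ Ω, HasFDerivWithinAt (fun x => e (f x))
      ((e ∘L fderiv ℂ f x).restrictScalars ℝ) Ω x := fun x hx =>
    ((e.hasFDerivAt.comp x (hf.differentiableAt (ho.mem_nhds hx)).hasFDerivAt).restrictScalars
      ℝ).hasFDerivWithinAt
  obtain ⟨F, hF⟩ := hc.exists_forall_hasFDerivWithinAt_of_hasFDerivWithinAt_symmetric hω (by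
    intro a _ x _ y _
    have h : ∀ x, fderiv ℂ f a x = x • fderiv ℂ f a 1 := fun x => by
      rw [← map_smul, smul_eq_mul, mul_one]
    simp [e, h x, h y, smul_smul, mul_comm])
  refine ⟨F, fun x hx => ?_⟩
  have := ((hF x hx).hasFDerivAt (ho.mem_nhds hx)).hasDerivAt
  simpa [e] using this

/-- Existence of holomorphic solutions of a linear equation `u' = T u + R` on a bounded convex
open set on which the coefficients are bounded; the solution is the series of Picard iterates. -/
lemma exists_linearODE_solution [CompleteSpace E] {Ω : Set ℂ} (ho : IsOpen Ω) (hc : Convex ℝ Ω)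
    (hb : Bornology.IsBounded Ω) {T : ℂ → E →L[ℂ] E} {R : ℂ → E} (hT : DifferentiableOn ℂ T Ω)
    (hR : DifferentiableOn ℂ R Ω) {K C : ℝ} (hK : ∀ x ∈ Ω, ‖T x‖ ≤ K) (hC : ∀ x ∈ Ω, ‖R x‖ ≤ C)
    {x₀ : ℂ} (hx₀ : x₀ ∈ Ω) (u₀ : E) :
    ∃ u : ℂ → E, u x₀ = u₀ ∧ ∀ x ∈ Ω, HasDerivAt u (T x (u x) + R x) x := by
  have hprim : ∀ f : ℂ → E, ∃ F : ℂ → E, DifferentiableOn ℂ f Ω →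
      F x₀ = 0 ∧ ∀ x ∈ Ω, HasDerivAt F (f x) x := by
    intro f
    by_cases hf : DifferentiableOn ℂ f Ω
    · obtain ⟨F, hF⟩ := exists_primitive_of_convex ho hc hf
      exact ⟨fun x => F x - F x₀, fun _ => ⟨sub_self _, fun x hx => (hF x hx).sub_const _⟩⟩
    · exact ⟨0, fun h => absurd h hf⟩
  choose P hP using hprim
  -- The Picard iterates.
  let F : ℕ → ℂ → E := fun m => Nat.rec (fun x => u₀ + P R x) (fun _ G => P (fun x => T x (G x))) m
  have hF0 : F 0 = fun x => u₀ + P R x := rfl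
  have hFs : ∀ m, F (m + 1) = P (fun x => T x (F m x)) := fun m => rfl
  have hdiff : ∀ m, DifferentiableOn ℂ (F m) Ω := by
    intro m
    induction m with
    | zero =>
      intro x hx
      exact (((hP R hR).2 x hx).const_add u₀).differentiableAt.differentiableWithinAt
    | succ m ih =>
      intro x hx
      exact ((hP _ (hT.clm_apply ih)).2 x hx).differentiableAt.differentiableWithinAt
  have hder : ∀ m, ∀ x ∈ Ω, HasDerivAt (F (m + 1)) (T x (F m x)) x := fun m x hx =>
    (hP _ (hT.clm_apply (hdiff m))).2 x hx
  have hzero : ∀ m, F (m + 1) x₀ = 0 := fun m => (hP _ (hT.clm_apply (hdiff m))).1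
  have hder0 : ∀ x ∈ Ω, HasDerivAt (F 0) (R x) x := fun x hx =>
    ((hP R hR).2 x hx).const_add u₀
  have hF00 : F 0 x₀ = u₀ := by simp [hF0, (hP R hR).1]
  obtain ⟨d, hd⟩ := hb.exists_norm_le
  set D : ℝ := d + d with hD
  have hdist : ∀ x ∈ Ω, ‖x - x₀‖ ≤ D := fun x hx =>
    (norm_sub_le _ _).trans (add_le_add (hd x hx) (hd x₀ hx₀))
  have hK0 : 0 ≤ K := (norm_nonneg _).trans (hK x₀ hx₀)
  have hC0 : 0 ≤ C := (norm_nonneg _).trans (hC x₀ hx₀)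
  have hD0 : 0 ≤ D := (norm_nonneg _).trans (hdist x₀ hx₀)
  set B : ℝ := ‖u₀‖ + C * D with hB
  have hB0 : 0 ≤ B := by positivity
  have hbound : ∀ m, ∀ x ∈ Ω, ‖F m x‖ ≤ B * ((K * ‖x - x₀‖) ^ m / m.factorial) := by
    intro m
    induction m with
    | zero =>
      intro x hx
      have h1 : ‖F 0 x - F 0 x₀‖ ≤ C * ‖x - x₀‖ :=
        hc.norm_image_sub_le_of_norm_hasDerivWithin_le
          (fun y hy => (hder0 y hy).hasDerivWithinAt) hC hx₀ hx
      have h2 : ‖F 0 x‖ ≤ ‖F 0 x₀‖ + ‖F 0 x - F 0 x₀‖ := by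
        simpa using norm_add_le (F 0 x₀) (F 0 x - F 0 x₀)
      rw [hF00] at h1 h2
      have := mul_le_mul_of_nonneg_left (hdist x hx) hC0
      simp only [pow_zero, Nat.factorial_zero, Nat.cast_one, div_one, mul_one]
      linarith
    | succ m ih =>
      intro x hx
      set δ := ‖x - x₀‖ with hδ
      have key := image_norm_le_of_norm_deriv_right_le_deriv_boundary
        (f := fun t : ℝ => F (m + 1) (x₀ + t * (x - x₀)))
        (f' := fun t : ℝ => (x - x₀) • T (x₀ + t * (x - x₀)) (F m (x₀ + t * (x - x₀))))
        (a := 0) (b := 1)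
        (B := fun t => B * ((K * (t * δ)) ^ (m + 1) / (m + 1).factorial))
        (B' := fun t => B * ((K * (t * δ)) ^ m / m.factorial * (K * δ)))
        (fun t ht => (hasDerivAt_comp_segmentParam
          (hder m _ (segmentParam_mem hc hx₀ hx ht))).continuousAt.continuousWithinAt)
        (fun t ht => (hasDerivAt_comp_segmentParam
          (hder m _ (segmentParam_mem hc hx₀ hx (Ico_subset_Icc_self ht)))).hasDerivWithinAt)
        (by simp [hzero])
        (by
          intro t
          have h1 : HasDerivAt (fun t : ℝ => K * (t * δ)) (K * δ) t := by
            simpa using ((hasDerivAt_id t).mul_const δ).const_mul K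
          have h2 := ((h1.pow (m + 1)).div_const ((m + 1).factorial : ℝ)).const_mul B
          refine h2.congr_deriv ?_
          rw [Nat.factorial_succ]
          push_cast
          have : (m.factorial : ℝ) ≠ 0 := by positivity
          field_simp)
        (by
          intro t ht
          have hm := segmentParam_mem hc hx₀ hx (Ico_subset_Icc_self ht)
          have h1 := ih _ hm
          have h2 : ‖x₀ + t * (x - x₀) - x₀‖ = t * δ := by
            rw [add_sub_cancel_left, norm_mul, Complex.norm_real, Real.norm_of_nonneg ht.1]
          rw [h2] at h1
          rw [norm_smul]
          calc δ * ‖T (x₀ + t * (x - x₀)) (F m (x₀ + t * (x - x₀)))‖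
              ≤ δ * (K * (B * ((K * (t * δ)) ^ m / m.factorial))) := by
                gcongr
                exact (ContinuousLinearMap.le_opNorm _ _).trans
                  (mul_le_mul (hK _ hm) h1 (norm_nonneg _) hK0)
            _ = _ := by ring)
        (right_mem_Icc.2 zero_le_one)
      simpa using key
  -- The derivative of the `m`-th iterate.
  let F' : ℕ → ℂ → E := fun m x => Nat.casesOn m (R x) (fun m => T x (F m x))
  let v : ℕ → ℝ := fun m => Nat.casesOn m C (fun m => K * (B * ((K * D) ^ m / m.factorial)))
  have hv : Summable v := by
    rw [← summable_nat_add_iff 1]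
    exact ((Real.summable_pow_div_factorial (K * D)).mul_left B).mul_left K
  have hF'v : ∀ m x, x ∈ Ω → ‖F' m x‖ ≤ v m := by
    intro m x hx
    cases m with
    | zero => exact hC x hx
    | succ m =>
      refine (ContinuousLinearMap.le_opNorm _ _).trans
        (mul_le_mul (hK _ hx) ((hbound m x hx).trans ?_) (norm_nonneg _) hK0)
      have := hdist x hx
      gcongr
  have hFF' : ∀ m x, x ∈ Ω → HasDerivAt (F m) (F' m x) x := by
    intro m x hx
    cases m with
    | zero => exact hder0 x hx
    | succ m => exact hder m x hx
  have hsum : ∀ x ∈ Ω, Summable fun m => F m x := fun x hx =>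
    Summable.of_norm_bounded ((Real.summable_pow_div_factorial (K * ‖x - x₀‖)).mul_left B)
      fun m => hbound m x hx
  refine ⟨fun x => ∑' m, F m x, ?_, fun x hx => ?_⟩
  · change ∑' m, F m x₀ = u₀
    rw [(hsum x₀ hx₀).tsum_eq_zero_add]
    simp [hzero, hF00]
  · have h := hasDerivAt_tsum_of_isPreconnected hv ho hc.isPreconnected hFF' hF'v hx₀
      (hsum x₀ hx₀) hx
    refine h.congr_deriv ?_
    have hs' : Summable fun m => F' m x := Summable.of_norm_bounded hv fun m => hF'v m x hx
    rw [hs'.tsum_eq_zero_add, add_comm]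
    congr 1
    exact ((T x).map_tsum (hsum x hx)).symm

/-- Uniqueness of solutions of a linear equation on a convex set. -/
lemma linearODE_solution_unique {Ω : Set ℂ} (hc : Convex ℝ Ω) {T : ℂ → E →L[ℂ] E} {R : ℂ → E}
    (hT : ContinuousOn T Ω) {u v : ℂ → E} (hu : ∀ x ∈ Ω, HasDerivAt u (T x (u x) + R x) x)
    (hv : ∀ x ∈ Ω, HasDerivAt v (T x (v x) + R x) x) {x₀ : ℂ} (hx₀ : x₀ ∈ Ω)
    (h₀ : u x₀ = v x₀) : ∀ x ∈ Ω, u x = v x := by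
  intro x hx
  have hγ : ContinuousOn (fun t : ℝ => T (x₀ + t * (x - x₀))) (Icc 0 1) :=
    hT.comp (by fun_prop) fun t ht => segmentParam_mem hc hx₀ hx ht
  obtain ⟨K, hK⟩ := isCompact_Icc.exists_bound_of_continuousOn hγ
  have hder : ∀ t ∈ Icc (0 : ℝ) 1,
      HasDerivAt (fun t : ℝ => u (x₀ + t * (x - x₀)) - v (x₀ + t * (x - x₀)))
        ((x - x₀) • T (x₀ + t * (x - x₀)) (u (x₀ + t * (x - x₀)) - v (x₀ + t * (x - x₀)))) t := by
    intro t ht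
    have hm := segmentParam_mem hc hx₀ hx ht
    refine ((hasDerivAt_comp_segmentParam (hu _ hm)).sub
      (hasDerivAt_comp_segmentParam (hv _ hm))).congr_deriv ?_
    rw [map_sub, ← smul_sub]
    congr 1
    abel
  have := eq_zero_of_abs_deriv_le_mul_abs_self_of_eq_zero_right
    (K := ‖x - x₀‖ * K)
    (fun t ht => (hder t ht).continuousAt.continuousWithinAt)
    (fun t ht => (hder t (Ico_subset_Icc_self ht)).hasDerivWithinAt)
    (by simp [h₀])
    (fun t ht => by
      rw [norm_smul, mul_assoc]
      gcongr
      exact (ContinuousLinearMap.le_opNorm _ _).trans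
        (mul_le_mul_of_nonneg_right (hK t (Ico_subset_Icc_self ht)) (norm_nonneg _)))
    1 (right_mem_Icc.2 zero_le_one)
  simpa [sub_eq_zero] using this

/-- If the coefficients are holomorphic on an open set `W`, solutions of `u' = T u + R` exist on a
convex neighbourhood of any segment in `W`. -/
lemma exists_linearODE_solution_near_segment [CompleteSpace E] {W : Set ℂ} (hW : IsOpen W)
    {T : ℂ → E →L[ℂ] E} {R : ℂ → E} (hT : DifferentiableOn ℂ T W) (hR : DifferentiableOn ℂ R W)
    {x₀ x₁ : ℂ} (hseg : segment ℝ x₀ x₁ ⊆ W) (u₀ : E) :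
    ∃ Ω, IsOpen Ω ∧ Convex ℝ Ω ∧ segment ℝ x₀ x₁ ⊆ Ω ∧ Ω ⊆ W ∧
      ∃ u : ℂ → E, u x₀ = u₀ ∧ ∀ x ∈ Ω, HasDerivAt u (T x (u x) + R x) x := by
  have hcomp : IsCompact (segment ℝ x₀ x₁) := isCompact_segment _ _
  obtain ⟨δ, hδ, hsub⟩ := hcomp.exists_cthickening_subset_open hW hseg
  have hcc : IsCompact (Metric.cthickening δ (segment ℝ x₀ x₁)) := hcomp.cthickening
  have hle := Metric.thickening_subset_cthickening δ (segment ℝ x₀ x₁)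
  obtain ⟨K, hK⟩ := hcc.exists_bound_of_continuousOn (hT.continuousOn.mono hsub)
  obtain ⟨C, hC⟩ := hcc.exists_bound_of_continuousOn (hR.continuousOn.mono hsub)
  have hs := Metric.self_subset_thickening hδ (segment ℝ x₀ x₁)
  have hcx := (convex_segment x₀ x₁).thickening δ
  exact ⟨_, Metric.isOpen_thickening, hcx, hs, hle.trans hsub,
    exists_linearODE_solution Metric.isOpen_thickening hcx (hcc.isBounded.subset hle)
      (hT.mono (hle.trans hsub)) (hR.mono (hle.trans hsub)) (fun x hx => hK x (hle hx))
      (fun x hx => hC x (hle hx)) (hs (left_mem_segment ℝ x₀ x₁)) u₀⟩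

end LinearODE

/-! ### Dependence of solutions on a parameter -/

section ParameterDerivative

variable {𝔸 : Type*} [NormedRing 𝔸] [NormedAlgebra ℂ 𝔸]

lemma gronwallBound_mul_left (r δ K ε x : ℝ) :
    gronwallBound (r * δ) K (r * ε) x = r * gronwallBound δ K ε x := by
  unfold gronwallBound
  split_ifs <;> ring

/-- Differentiability of solutions of `Y' = M Y` in a parameter, along a segment.  If `M` is
differentiable in the parameter at `s₀`, uniformly on the segment, and `Y` is so at one end, then
`∂Y/∂s` exists at the other end and is the solution `V` of the variational equation. -/
lemma hasDerivAt_param_of_linearODE {M : ℂ → ℂ → 𝔸} {M' : ℂ → 𝔸} {Y : ℂ → ℂ → 𝔸} {V : ℂ → 𝔸}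
    {s₀ x₀ x : ℂ}
    (hY : ∀ᶠ s in 𝓝 s₀, ∀ y ∈ segment ℝ x₀ x, HasDerivAt (Y s) (M s y * Y s y) y)
    (hV : ∀ y ∈ segment ℝ x₀ x, HasDerivAt V (M s₀ y * V y + M' y * Y s₀ y) y)
    (hM : (fun p : ℂ × ℂ => M p.1 p.2 - M s₀ p.2 - (p.1 - s₀) • M' p.2)
      =o[𝓝 s₀ ×ˢ 𝓟 (segment ℝ x₀ x)] fun p => p.1 - s₀)
    (hM₀ : ContinuousOn (M s₀) (segment ℝ x₀ x)) (hM' : ContinuousOn M' (segment ℝ x₀ x))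
    (h₀ : HasDerivAt (fun s => Y s x₀) (V x₀) s₀) :
    HasDerivAt (fun s => Y s x) (V x) s₀ := by
  have hcomp : IsCompact (segment ℝ x₀ x) := isCompact_segment _ _
  have hY₀ := hY.self_of_nhds
  obtain ⟨K, hK⟩ := hcomp.exists_bound_of_continuousOn hM₀
  obtain ⟨K', hK'⟩ := hcomp.exists_bound_of_continuousOn hM'
  obtain ⟨CY, hCY⟩ := hcomp.exists_bound_of_continuousOn
    (fun y hy => (hY₀ y hy).continuousAt.continuousWithinAt)
  obtain ⟨CV, hCV⟩ := hcomp.exists_bound_of_continuousOn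
    (fun y hy => (hV y hy).continuousAt.continuousWithinAt)
  have hx₀ := left_mem_segment ℝ x₀ x
  have hK'0 : 0 ≤ K' := (norm_nonneg _).trans (hK' x₀ hx₀)
  have hCY0 : 0 ≤ CY := (norm_nonneg _).trans (hCY x₀ hx₀)
  have hCV0 : 0 ≤ CV := (norm_nonneg _).trans (hCV x₀ hx₀)
  set d : ℝ := ‖x - x₀‖
  set G : ℝ := gronwallBound 1 (d * (K + 1)) (d * (CY + 1)) 1 with hG
  rw [hasDerivAt_iff_isLittleO, isLittleO_iff] at h₀ ⊢
  intro ε hε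
  set η : ℝ := min 1 (ε / (|G| + 1)) with hη
  have hη0 : 0 < η := lt_min one_pos (by positivity)
  have hη1 : η ≤ 1 := min_le_left _ _
  have hηG : η * G ≤ ε := by
    calc η * G ≤ η * (|G| + 1) := by gcongr; linarith [le_abs_self G]
      _ ≤ ε / (|G| + 1) * (|G| + 1) := by gcongr; exact min_le_right _ _
      _ = ε := by field_simp
  have hsmall : ∀ᶠ s in 𝓝 s₀, (K' + 1) * ‖s - s₀‖ < 1 ∧ (K' + 1) * CV * ‖s - s₀‖ < η := by
    refine ContinuousAt.eventually_lt (by fun_prop) continuousAt_const (by simp) |>.and ?_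
    exact ContinuousAt.eventually_lt (by fun_prop) continuousAt_const (by simpa using hη0)
  have hMev := eventually_prod_principal_iff.1 (isLittleO_iff.1 hM hη0)
  filter_upwards [hY, hsmall, hMev, h₀ hη0] with s hYs hs hMs h₀s
  set h : ℝ := ‖s - s₀‖ with hh
  have hh0 : 0 ≤ h := norm_nonneg _
  have hMdiff : ∀ y ∈ segment ℝ x₀ x, ‖M s y - M s₀ y‖ ≤ (K' + 1) * h := by
    intro y hy
    have h1 := hMs y hy
    have h2 : ‖(s - s₀) • M' y‖ ≤ h * K' := by
      rw [norm_smul]; gcongr; exact hK' y hy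
    have h3 := norm_add_le (M s y - M s₀ y - (s - s₀) • M' y) ((s - s₀) • M' y)
    rw [sub_add_cancel] at h3
    have h4 : η * ‖s - s₀‖ ≤ h := mul_le_of_le_one_left hh0 hη1
    linarith
  -- The error of the first order approximation of `Y s` satisfies a linear differential
  -- inequality with inhomogeneity `o(s - s₀)`.
  set Δ : ℂ → 𝔸 := fun y => Y s y - Y s₀ y - (s - s₀) • V y with hΔ
  set Δ' : ℂ → 𝔸 := fun y => M s y * Δ y + ((M s y - M s₀ y - (s - s₀) • M' y) * Y s₀ y +
    (s - s₀) • ((M s y - M s₀ y) * V y)) with hΔ'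
  have hΔder : ∀ y ∈ segment ℝ x₀ x, HasDerivAt Δ (Δ' y) y := by
    intro y hy
    refine (((hYs y hy).sub (hY₀ y hy)).sub ((hV y hy).const_smul (s - s₀))).congr_deriv ?_
    simp only [hΔ', hΔ, mul_sub, sub_mul, smul_add, smul_sub, mul_smul_comm, smul_mul_assoc]
    abel
  have hΔbound : ∀ y ∈ segment ℝ x₀ x,
      ‖Δ' y‖ ≤ (K + 1) * ‖Δ y‖ + η * h * (CY + 1) := by
    intro y hy
    have h1 : ‖M s y‖ ≤ K + 1 := by
      have := norm_add_le (M s₀ y) (M s y - M s₀ y)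
      rw [add_sub_cancel] at this
      linarith [hK y hy, hMdiff y hy]
    have h2 : ‖M s y * Δ y‖ ≤ (K + 1) * ‖Δ y‖ := (norm_mul_le _ _).trans (by gcongr)
    have h3 : ‖(M s y - M s₀ y - (s - s₀) • M' y) * Y s₀ y‖ ≤ η * h * CY :=
      (norm_mul_le _ _).trans (mul_le_mul (hMs y hy) (hCY y hy) (norm_nonneg _) (by positivity))
    have h4 : ‖(s - s₀) • ((M s y - M s₀ y) * V y)‖ ≤ h * η := by
      rw [norm_smul]
      refine mul_le_mul_of_nonneg_left ?_ hh0
      calc ‖(M s y - M s₀ y) * V y‖ ≤ (K' + 1) * h * CV :=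
            (norm_mul_le _ _).trans
              (mul_le_mul (hMdiff y hy) (hCV y hy) (norm_nonneg _) (by positivity))
        _ = (K' + 1) * CV * h := by ring
        _ ≤ η := hs.2.le
    have h5 := norm_add₃_le (a := M s y * Δ y)
      (b := (M s y - M s₀ y - (s - s₀) • M' y) * Y s₀ y)
      (c := (s - s₀) • ((M s y - M s₀ y) * V y))
    simp only [hΔ', ← add_assoc]
    linarith
  have hmem : ∀ t ∈ Icc (0 : ℝ) 1, x₀ + t * (x - x₀) ∈ segment ℝ x₀ x := fun t ht =>
    segmentParam_mem (convex_segment x₀ x) hx₀ (right_mem_segment ℝ x₀ x) ht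
  have key := norm_le_gronwallBound_of_norm_deriv_right_le
    (f := fun t : ℝ => Δ (x₀ + t * (x - x₀)))
    (f' := fun t : ℝ => (x - x₀) • Δ' (x₀ + t * (x - x₀)))
    (δ := η * h * 1) (K := d * (K + 1)) (ε := η * h * (d * (CY + 1))) (a := 0) (b := 1)
    (fun t ht => (hasDerivAt_comp_segmentParam
      (hΔder _ (hmem t ht))).continuousAt.continuousWithinAt)
    (fun t ht => (hasDerivAt_comp_segmentParam
      (hΔder _ (hmem t (Ico_subset_Icc_self ht)))).hasDerivWithinAt)
    (by simpa [hΔ] using h₀s)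
    (fun t ht => by
      rw [norm_smul]
      refine (mul_le_mul_of_nonneg_left (hΔbound _ (hmem t (Ico_subset_Icc_self ht)))
        (norm_nonneg _)).trans (le_of_eq ?_)
      ring)
    1 (right_mem_Icc.2 zero_le_one)
  rw [gronwallBound_mul_left, sub_zero, ← hG] at key
  have h6 : ‖Δ x‖ ≤ η * h * G := by simpa using key
  calc ‖Y s x - Y s₀ x - (s - s₀) • V x‖ ≤ η * h * G := h6
    _ = η * G * h := by ring
    _ ≤ ε * h := by gcongr

/-- The coefficient `A s / (x - β s)` is differentiable in `s`, uniformly for `x` in a compact set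
that avoids the pole. -/
lemma isLittleO_pole_param {A : ℂ → 𝔸} {A' : 𝔸} {β : ℂ → ℂ} {β' s₀ : ℂ} {K : Set ℂ}
    (hA : HasDerivAt A A' s₀) (hβ : HasDerivAt β β' s₀) (hK : IsCompact K) (hβK : β s₀ ∉ K) :
    (fun p : ℂ × ℂ => (p.2 - β p.1)⁻¹ • A p.1 - (p.2 - β s₀)⁻¹ • A s₀ -
      (p.1 - s₀) • ((p.2 - β s₀)⁻¹ • A' + (β' * ((p.2 - β s₀)⁻¹) ^ 2) • A s₀))
      =o[𝓝 s₀ ×ˢ 𝓟 K] fun p => p.1 - s₀ := by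
  obtain ⟨ρ, hρ, hρK⟩ : ∃ ρ > 0, ∀ x ∈ K, ρ ≤ ‖x - β s₀‖ := by
    obtain ⟨ρ, hρ, h⟩ := Metric.isOpen_iff.1 hK.isClosed.isOpen_compl (β s₀) hβK
    refine ⟨ρ, hρ, fun x hx => ?_⟩
    by_contra! hlt
    exact h (by simpa [dist_eq_norm] using hlt) hx
  have hnear : ∀ᶠ p : ℂ × ℂ in 𝓝 s₀ ×ˢ 𝓟 K, p.2 ∈ K ∧ ‖β p.1 - β s₀‖ < ρ / 2 := by
    rw [eventually_prod_principal_iff]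
    have := hβ.continuousAt.eventually (Metric.ball_mem_nhds (β s₀) (half_pos hρ))
    filter_upwards [this] with s hs x hx
    exact ⟨hx, by simpa [dist_eq_norm] using hs⟩
  have hfar : ∀ᶠ p : ℂ × ℂ in 𝓝 s₀ ×ˢ 𝓟 K, ρ / 2 ≤ ‖p.2 - β p.1‖ ∧ ρ / 2 ≤ ‖p.2 - β s₀‖ := by
    filter_upwards [hnear] with p hp
    have h1 := hρK p.2 hp.1
    have h2 := norm_sub_le (p.2 - β s₀) (p.2 - β p.1)
    have h3 := norm_add_le (p.2 - β p.1) (β p.1 - β s₀)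
    rw [sub_add_sub_cancel] at h3
    exact ⟨by linarith [hp.2], by linarith⟩
  have hone : ∀ r : ℂ × ℂ → ℂ, (∀ᶠ p : ℂ × ℂ in 𝓝 s₀ ×ˢ 𝓟 K, ρ / 2 ≤ ‖r p‖) →
      (fun p => (r p)⁻¹) =O[𝓝 s₀ ×ˢ 𝓟 K] fun _ => (1 : ℂ) := by
    intro r hr
    refine IsBigO.of_bound (ρ / 2)⁻¹ ?_
    filter_upwards [hr] with p hp
    rw [norm_inv, norm_one, mul_one]
    gcongr
  have hr : (fun p : ℂ × ℂ => (p.2 - β p.1)⁻¹) =O[𝓝 s₀ ×ˢ 𝓟 K] fun _ => (1 : ℂ) :=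
    hone _ (hfar.mono fun _ h => h.1)
  have hr₀ : (fun p : ℂ × ℂ => (p.2 - β s₀)⁻¹) =O[𝓝 s₀ ×ˢ 𝓟 K] fun _ => (1 : ℂ) :=
    hone _ (hfar.mono fun _ h => h.2)
  have hfst : Tendsto (fun p : ℂ × ℂ => p.1) (𝓝 s₀ ×ˢ 𝓟 K) (𝓝 s₀) := tendsto_fst
  have hAo : (fun p : ℂ × ℂ => A p.1 - A s₀ - (p.1 - s₀) • A') =o[𝓝 s₀ ×ˢ 𝓟 K]
      fun p => p.1 - s₀ := (hasDerivAt_iff_isLittleO.1 hA).comp_tendsto hfst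
  have hβo : (fun p : ℂ × ℂ => β p.1 - β s₀ - (p.1 - s₀) * β') =o[𝓝 s₀ ×ˢ 𝓟 K]
      fun p => p.1 - s₀ := (hasDerivAt_iff_isLittleO.1 hβ).comp_tendsto hfst
  have hβO : (fun p : ℂ × ℂ => β p.1 - β s₀) =O[𝓝 s₀ ×ˢ 𝓟 K] fun p => p.1 - s₀ :=
    hβ.differentiableAt.isBigO_sub.comp_tendsto hfst
  have hs1 : (fun p : ℂ × ℂ => p.1 - s₀) =o[𝓝 s₀ ×ˢ 𝓟 K] fun _ => (1 : ℂ) := by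
    rw [isLittleO_one_iff]
    simpa using hfst.sub_const s₀
  have hβ1 : (fun p : ℂ × ℂ => β p.1 - β s₀) =o[𝓝 s₀ ×ˢ 𝓟 K] fun _ => (1 : ℂ) :=
    hβO.trans_isLittleO hs1
  -- errors of the first order expansions of `A` and of `(x - β)⁻¹`, and the mixed second order
  -- term
  have e1 := hr.smul_isLittleO hAo
  simp only [one_smul] at e1
  have e2 : (fun p : ℂ × ℂ => ((β p.1 - β s₀ - (p.1 - s₀) * β') * ((p.2 - β s₀)⁻¹) ^ 2 +
      (β p.1 - β s₀) * (β p.1 - β s₀) * ((p.2 - β p.1)⁻¹ * ((p.2 - β s₀)⁻¹) ^ 2)) • A s₀)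
      =o[𝓝 s₀ ×ˢ 𝓟 K] fun p => p.1 - s₀ := by
    have h1 := hβo.mul_isBigO (hr₀.pow 2)
    have h2 := (hβ1.mul_isBigO hβO).mul_isBigO (hr.mul (hr₀.pow 2))
    simp only [one_pow, mul_one, one_mul] at h1 h2
    refine ((h1.add h2).smul_isBigO (isBigO_const_const (A s₀)
      (one_ne_zero (α := ℂ)) _)).congr_right ?_
    intro p; simp
  have e3 : (fun p : ℂ × ℂ => ((β p.1 - β s₀) * ((p.2 - β p.1)⁻¹ * (p.2 - β s₀)⁻¹)) •
      ((p.1 - s₀) • A')) =o[𝓝 s₀ ×ˢ 𝓟 K] fun p => p.1 - s₀ := by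
    have h1 := hβ1.mul_isBigO (hr.mul hr₀)
    have h2 : (fun p : ℂ × ℂ => (p.1 - s₀) • A') =O[𝓝 s₀ ×ˢ 𝓟 K] fun p => p.1 - s₀ := by
      refine ((isBigO_refl (fun p : ℂ × ℂ => p.1 - s₀) _).smul
        (isBigO_const_const A' (one_ne_zero (α := ℂ)) _)).congr_right ?_
      intro p; simp
    refine (h1.smul_isBigO h2).congr_right ?_
    intro p; simp
  have e := (e1.add e2).add e3
  refine e.congr' ?_ EventuallyEq.rfl
  filter_upwards [hfar] with p hp
  have hp1 : p.2 - β p.1 ≠ 0 := norm_pos_iff.1 (lt_of_lt_of_le (half_pos hρ) hp.1)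
  have hp2 : p.2 - β s₀ ≠ 0 := norm_pos_iff.1 (lt_of_lt_of_le (half_pos hρ) hp.2)
  match_scalars <;> field_simp <;> ring

end ParameterDerivative

/-! ### The cut plane and the branch of the logarithm -/

section CutPlane

/-- The rotation factor `e^{-iθ}` that turns the cuts into left horizontal rays. -/
noncomputable def rot (θ : ℝ) : ℂ := Complex.exp (-(θ * Complex.I))

lemma rot_ne_zero (θ : ℝ) : rot θ ≠ 0 := Complex.exp_ne_zero _

lemma norm_rot (θ : ℝ) : ‖rot θ‖ = 1 := by
  have : rot θ = Complex.exp ((-θ : ℝ) * Complex.I) := by simp [rot]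
  rw [this, Complex.norm_exp_ofReal_mul_I]

variable {n : ℕ} {θ : ℝ} {a : Fin n → ℂ} {x : ℂ}

lemma mem_cutPlane_iff : x ∈ cutPlane θ a ↔ ∀ j, rot θ * (x - a j) ∈ Complex.slitPlane := Iff.rfl

lemma isOpen_setOf_mem_cutPlane (θ : ℝ) (n : ℕ) :
    IsOpen {z : (Fin n → ℂ) × ℂ | z.2 ∈ cutPlane θ z.1} := by
  simp only [mem_cutPlane_iff, ofPred_forall]
  exact isOpen_iInter_of_finite fun j => Complex.isOpen_slitPlane.preimage (by fun_prop)

lemma isOpen_cutPlane (θ : ℝ) (a : Fin n → ℂ) : IsOpen (cutPlane θ a) :=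
  (isOpen_setOf_mem_cutPlane θ n).preimage (f := fun x => (a, x)) (by fun_prop)

lemma sub_ne_zero_of_mem_cutPlane (hx : x ∈ cutPlane θ a) (j : Fin n) : x - a j ≠ 0 := by
  intro h
  have := hx j
  rw [h, mul_zero] at this
  exact Complex.zero_notMem_slitPlane this

lemma mem_cutPlane_of_im_ne_zero (h : ∀ j, (rot θ * (x - a j)).im ≠ 0) : x ∈ cutPlane θ a :=
  fun j => Complex.mem_slitPlane_iff.2 (Or.inr (h j))

lemma dense_cutPlane (θ : ℝ) (a : Fin n → ℂ) : Dense (cutPlane θ a) := by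
  intro x
  -- Move off the cuts perpendicularly to their common direction.
  let p : ℝ → ℂ := fun t => x + (rot θ)⁻¹ * (t * Complex.I)
  have hp : Continuous p := by fun_prop
  let S : Set ℝ := range fun j => -(rot θ * (x - a j)).im
  have hS : Dense Sᶜ := (Set.finite_range _).countable.dense_compl ℝ
  have h0 : p 0 ∈ closure (p '' Sᶜ) := image_closure_subset_closure_image hp ⟨0, hS 0, rfl⟩
  have hp0 : p 0 = x := by simp [p]
  rw [hp0] at h0
  refine closure_mono ?_ h0
  rintro _ ⟨t, ht, rfl⟩
  refine mem_cutPlane_of_im_ne_zero fun j hj => ht ⟨j, ?_⟩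
  have : rot θ * (p t - a j) = rot θ * (x - a j) + t * Complex.I := by
    have := rot_ne_zero θ
    simp only [p]; field_simp; ring
  rw [this] at hj
  simp at hj
  dsimp only
  simp
  linarith

/-- Rays in the direction opposite to the cuts stay in the cut plane. -/
lemma add_ray_mem_cutPlane (hx : x ∈ cutPlane θ a) {t : ℝ} (ht : 0 ≤ t) :
    x + t * (rot θ)⁻¹ ∈ cutPlane θ a := by
  intro j
  have h : rot θ * (x + t * (rot θ)⁻¹ - a j) = rot θ * (x - a j) + t := by
    have := rot_ne_zero θ
    field_simp; ring
  change rot θ * (x + t * (rot θ)⁻¹ - a j) ∈ _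
  rw [h]
  rcases Complex.mem_slitPlane_iff.1 (mem_cutPlane_iff.1 hx j) with h | h
  · left; rw [Complex.add_re, Complex.ofReal_re]; linarith
  · right; simpa using h

lemma segment_ray_subset_cutPlane (hx : x ∈ cutPlane θ a) {t : ℝ} (ht : 0 ≤ t) :
    segment ℝ (x + t * (rot θ)⁻¹) x ⊆ cutPlane θ a := by
  rw [segment_symm, segment_eq_image']
  rintro _ ⟨r, hr, rfl⟩
  have := add_ray_mem_cutPlane hx (mul_nonneg hr.1 ht)
  convert this using 1
  simp [mul_assoc]

lemma mem_cutPlane_of_re_lt (h : ∀ j, (rot θ * a j).re < (rot θ * x).re) : x ∈ cutPlane θ a := by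
  intro j
  left
  change 0 < (rot θ * (x - a j)).re
  rw [mul_sub, Complex.sub_re]
  linarith [h j]

lemma hasDerivAt_branchLog {z : ℂ} (hz : rot θ * z ∈ Complex.slitPlane) :
    HasDerivAt (branchLog θ) z⁻¹ z := by
  have hz0 : z ≠ 0 := by
    rintro rfl
    simp at hz
  have h1 : HasDerivAt (fun z => rot θ * z) (rot θ) z := by
    simpa using (hasDerivAt_id z).const_mul (rot θ)
  refine ((h1.clog hz).add_const (θ * Complex.I)).congr_deriv ?_
  have := rot_ne_zero θ
  field_simp

lemma hasDerivAt_branchLog_sub (hx : x ∈ cutPlane θ a) (j : Fin n) :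
    HasDerivAt (fun x => branchLog θ (x - a j)) (x - a j)⁻¹ x :=
  (hasDerivAt_branchLog (mem_cutPlane_iff.1 hx j)).comp_sub_const x (a j)

lemma rot_mul_im_ne_zero_of_cutsDisjoint (h : CutsDisjoint θ a) {i j : Fin n} (hij : i ≠ j) :
    (rot θ * (a j - a i)).im ≠ 0 := h j i hij.symm

lemma analyticAt_branchLog_sub (h : CutsDisjoint θ a) {i j : Fin n} (hij : i ≠ j) :
    AnalyticAt ℂ (fun x => branchLog θ (x - a i)) (a j) := by
  have hmem : rot θ * (a j - a i) ∈ Complex.slitPlane :=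
    Complex.mem_slitPlane_iff.2 (Or.inr (rot_mul_im_ne_zero_of_cutsDisjoint h hij))
  have hev : ∀ᶠ x in 𝓝 (a j), rot θ * (x - a i) ∈ Complex.slitPlane :=
    ContinuousAt.preimage_mem_nhds (by fun_prop) (Complex.isOpen_slitPlane.mem_nhds hmem)
  rw [Complex.analyticAt_iff_eventually_differentiableAt]
  filter_upwards [hev] with x hx
  exact ((hasDerivAt_branchLog hx).comp_sub_const x (a i)).differentiableAt

lemma sub_ne_zero_of_cutsDisjoint (h : CutsDisjoint θ a) {i j : Fin n} (hij : i ≠ j) :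
    a j - a i ≠ 0 := by
  intro h0
  apply rot_mul_im_ne_zero_of_cutsDisjoint h hij
  simp [h0]

/-- The logarithms of `x - a` and `x` agree asymptotically along the ray `x = t e^{iθ}`. -/
lemma tendsto_branchLog_sub_branchLog (θ : ℝ) (a : ℂ) :
    Tendsto (fun t : ℝ => branchLog θ (t * (rot θ)⁻¹ - a) - branchLog θ (t * (rot θ)⁻¹))
      atTop (𝓝 0) := by
  have hinv : Tendsto (fun t : ℝ => ((t : ℂ))⁻¹) atTop (𝓝 0) := by
    have := (Complex.continuous_ofReal.tendsto 0).comp tendsto_inv_atTop_zero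
    simpa [Function.comp_def] using this
  have h1 : Tendsto (fun t : ℝ => 1 - rot θ * a * (t : ℂ)⁻¹) atTop (𝓝 1) := by
    simpa using (hinv.const_mul (rot θ * a)).const_sub 1
  have h2 : Tendsto (fun t : ℝ => Complex.log (1 - rot θ * a * (t : ℂ)⁻¹)) atTop (𝓝 0) := by
    have := h1.clog Complex.one_mem_slitPlane
    simpa using this
  refine h2.congr' ?_
  filter_upwards [eventually_gt_atTop 0, h1.eventually_ne one_ne_zero] with t ht h0
  have ht' : (t : ℂ) ≠ 0 := by exact_mod_cast ht.ne'
  have hr := rot_ne_zero θ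
  have e1 : rot θ * (t * (rot θ)⁻¹ - a) = t * (1 - rot θ * a * (t : ℂ)⁻¹) := by
    field_simp
  have e2 : rot θ * (t * (rot θ)⁻¹) = t := by
    field_simp
  change _ = Complex.log (rot θ * (t * (rot θ)⁻¹ - a)) + _
    - (Complex.log (rot θ * (t * (rot θ)⁻¹)) + _)
  rw [e1, e2, Complex.log_ofReal_mul ht h0, ← Complex.ofReal_log ht.le]
  ring

lemma analyticAt_inv_sub {x a : ℂ} (hx : x - a ≠ 0) : AnalyticAt ℂ (fun x => (x - a)⁻¹) x :=
  (analyticAt_id.sub analyticAt_const).inv hx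

lemma hasDerivAt_inv_sub {x a : ℂ} (hx : x - a ≠ 0) :
    HasDerivAt (fun x => (x - a)⁻¹) (-((x - a)⁻¹) ^ 2) x := by
  refine (((hasDerivAt_id x).sub_const a).inv hx).congr_deriv ?_
  simp [inv_pow, neg_div]

lemma differentiableOn_sum_pole {𝔸 : Type*} [NormedAddCommGroup 𝔸] [NormedSpace ℂ 𝔸]
    {a c : Fin n → ℂ} (m : ℕ) (B : Fin n → 𝔸) :
    DifferentiableOn ℂ (fun x => ∑ i, (c i * ((x - a i)⁻¹) ^ m) • B i) {x | ∀ i, x - a i ≠ 0} := by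
  intro x hx
  have : ∀ i, DifferentiableAt ℂ (fun x => (x - a i)⁻¹) x := fun i =>
    (hasDerivAt_inv_sub (hx i)).differentiableAt
  exact (DifferentiableAt.fun_sum fun i _ =>
    (((this i).pow m).const_mul (c i)).smul_const (B i)).differentiableWithinAt

lemma cutPlane_subset : cutPlane θ a ⊆ {x | ∀ i, x - a i ≠ 0} :=
  fun _ hx i => sub_ne_zero_of_mem_cutPlane hx i

end CutPlane

/-! ### Entire functions -/

section EntireFunctions

variable {E : Type*} [NormedAddCommGroup E] [NormedSpace ℂ E]

/-- A function on a dense open set that continues analytically to a neighbourhood of every point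
extends to an entire function. -/
lemma exists_entire_extension [CompleteSpace E] {D : Set ℂ} (hD : Dense D) {u : ℂ → E}
    (h : ∀ x, ∃ e : ℂ → E, AnalyticAt ℂ e x ∧ ∀ᶠ y in 𝓝 x, y ∈ D → u y = e y) :
    ∃ F : ℂ → E, (∀ x, AnalyticAt ℂ F x) ∧ ∀ x ∈ D, F x = u x := by
  choose e he heu using h
  have hagree : ∀ x, ∀ᶠ y in 𝓝 x, e y y = e x y := by
    intro x
    filter_upwards [(heu x).eventually_nhds, (he x).eventually_analyticAt] with y hy hya
    have h1 : Tendsto u (𝓝[D] y) (𝓝 (e x y)) :=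
      (hya.continuousAt.tendsto.mono_left nhdsWithin_le_nhds).congr'
        ((eventually_nhdsWithin_iff.2 hy).mono fun _ h => h.symm)
    have h2 : Tendsto u (𝓝[D] y) (𝓝 (e y y)) :=
      ((he y).continuousAt.tendsto.mono_left nhdsWithin_le_nhds).congr'
        ((eventually_nhdsWithin_iff.2 (heu y)).mono fun _ h => h.symm)
    have : (𝓝[D] y).NeBot := mem_closure_iff_nhdsWithin_neBot.1 (hD y)
    exact tendsto_nhds_unique h2 h1
  exact ⟨fun x => e x x, fun x => (he x).congr ((hagree x).mono fun _ h => h.symm),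
    fun x hx => ((heu x).self_of_nhds hx).symm⟩

lemma isPreconnected_setOf_lt_norm (r : ℝ) (hr : 0 < r) : IsPreconnected {x : ℂ | r < ‖x‖} := by
  have : {x : ℂ | r < ‖x‖} = Complex.exp '' {z | Real.log r < z.re} := by
    ext x
    constructor
    · intro hx
      have hx0 : 0 < ‖x‖ := hr.trans hx
      refine ⟨Complex.log x, ?_, Complex.exp_log (norm_pos_iff.1 hx0)⟩
      simpa [Complex.log_re] using Real.log_lt_log hr hx
    · rintro ⟨z, hz, rfl⟩
      simpa [Complex.norm_exp, Real.log_lt_iff_lt_exp hr] using hz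
  rw [this]
  exact (convex_halfSpace_re_gt _).isPreconnected.image _ Complex.continuous_exp.continuousOn

/-- An entire function `P` that is holomorphic in `1/x` on a half plane is constant: by the
identity theorem the expansion holds all around `∞`, and Liouville's theorem applies. -/
lemma entire_eq_const_of_analyticAt_inv_halfPlane [CompleteSpace E] {P T : ℂ → E} {θ R : ℝ}
    (hP : ∀ x, AnalyticAt ℂ P x) (hT : AnalyticAt ℂ T 0)
    (h : ∀ x, R < (rot θ * x).re → P x = T x⁻¹) (x : ℂ) : P x = T 0 := by
  obtain ⟨ρ, hρ, hTρ⟩ := Metric.eventually_nhds_iff.1 hT.eventually_analyticAt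
  have hTinv : AnalyticOnNhd ℂ (fun x => T x⁻¹) {x | ρ⁻¹ < ‖x‖} := by
    intro y hy
    have hy0 : 0 < ‖y‖ := (inv_pos.2 hρ).trans hy
    refine AnalyticAt.comp (g := T) (f := fun x => x⁻¹) (hTρ ?_)
      (analyticAt_inv (norm_pos_iff.1 hy0))
    rw [dist_zero_right, norm_inv]
    exact inv_lt_of_inv_lt₀ hρ hy
  -- a point in the half plane that is far away
  set t : ℝ := max (R + 1) (ρ⁻¹ + 1)
  have ht1 : R < t := (lt_add_one R).trans_le (le_max_left _ _)
  have ht2 : ρ⁻¹ < t := (lt_add_one _).trans_le (le_max_right _ _)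
  have ht0 : 0 < t := (inv_pos.2 hρ).trans ht2
  set y : ℂ := (rot θ)⁻¹ * t
  have hy1 : rot θ * y = t := mul_inv_cancel_left₀ (rot_ne_zero θ) _
  have hy2 : ‖y‖ = t := by simp [y, norm_rot, abs_of_pos ht0]
  have hnear : P =ᶠ[𝓝 y] fun x => T x⁻¹ := by
    have : ∀ᶠ x in 𝓝 y, R < (rot θ * x).re :=
      ContinuousAt.eventually_lt continuousAt_const
        (Complex.continuous_re.continuousAt.comp (by fun_prop)) (by simpa [hy1] using ht1)
    filter_upwards [this] with x hx using h x hx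
  have heq : EqOn P (fun x => T x⁻¹) {x | ρ⁻¹ < ‖x‖} :=
    AnalyticOnNhd.eqOn_of_preconnected_of_eventuallyEq (fun x _ => hP x) hTinv
      (isPreconnected_setOf_lt_norm _ (inv_pos.2 hρ)) (z₀ := y) (by simpa [hy2] using ht2) hnear
  have hlim : Tendsto P (Bornology.cobounded ℂ) (𝓝 (T 0)) := by
    refine (hT.continuousAt.tendsto.comp tendsto_inv₀_cobounded).congr' ?_
    filter_upwards [(tendsto_norm_cobounded_atTop (E := ℂ)).eventually_gt_atTop ρ⁻¹] with x hx
    exact (heq hx).symm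
  have hdiff : Differentiable ℂ P := fun x => (hP x).differentiableAt
  exact hdiff.apply_eq_of_tendsto_cocompact x (by rwa [← Metric.cobounded_eq_cocompact])

end EntireFunctions

/-! ### Deformations that change only the scalar part of the exponents -/

section ScalarDeformation

variable {𝔸 : Type*} [NormedRing 𝔸] [NormedAlgebra ℂ 𝔸]

/-- One-parameter family of Fuchsian systems in a Banach algebra, with solutions `Y s` on the
cut planes, whose local exponents at the singular points `b s j` and at infinity change only in
their scalar part as `s` varies near `s₀`.  The exponents are `L j + φ j s • 1` at `b s j`, and
the solution behaves like `x ^ (Λ + ψ s • 1)` at infinity. The derivatives at `s₀` of `b · j`,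
`φ j`, `ψ` are `b' j`, `f j`, `g`. -/
structure IsScalarDeformation {n : ℕ} (θ : ℝ) (s₀ : ℂ) (b : ℂ → Fin n → ℂ) (b' : Fin n → ℂ)
    (A : Fin n → ℂ → 𝔸) (L : Fin n → 𝔸) (φ : Fin n → ℂ → ℂ) (f : Fin n → ℂ) (Λ : 𝔸) (ψ : ℂ → ℂ)
    (g : ℂ) (Y : ℂ → ℂ → 𝔸) : Prop where
  hasDerivAt_b : ∀ j, HasDerivAt (fun s => b s j) (b' j) s₀
  φ_eq_zero : ∀ j, φ j s₀ = 0
  hasDerivAt_φ : ∀ j, HasDerivAt (φ j) (f j) s₀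
  ψ_eq_zero : ψ s₀ = 0
  hasDerivAt_ψ : HasDerivAt ψ g s₀
  cutsDisjoint : ∀ᶠ s in 𝓝 s₀, CutsDisjoint θ (b s)
  hasDerivAt : ∀ᶠ s in 𝓝 s₀, ∀ x ∈ cutPlane θ (b s),
    HasDerivAt (Y s) ((∑ i, (x - b s i)⁻¹ • A i s) * Y s x) x
  isUnit : ∀ x ∈ cutPlane θ (b s₀), IsUnit (Y s₀ x)
  local_expansion : ∀ j, ∃ G : ℂ × ℂ → 𝔸, AnalyticAt ℂ G (s₀, b s₀ j) ∧ IsUnit (G (s₀, b s₀ j)) ∧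
    ∀ᶠ z in 𝓝 (s₀, b s₀ j), z.2 ∈ cutPlane θ (b z.1) →
      Y z.1 z.2 = G z * NormedSpace.exp (branchLog θ (z.2 - b z.1 j) • (L j + φ j z.1 • (1 : 𝔸)))
  expansion_infty : ∃ H : ℂ × ℂ → 𝔸, AnalyticAt ℂ H (s₀, 0) ∧ (∀ᶠ s in 𝓝 s₀, H (s, 0) = 1) ∧
    ∃ R : ℝ, ∀ᶠ s in 𝓝 s₀, ∀ x : ℂ, R < (rot θ * x).re →
      Y s x = H (s, x⁻¹) * NormedSpace.exp (branchLog θ x • (Λ + ψ s • (1 : 𝔸)))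

namespace IsScalarDeformation

variable {n : ℕ} {θ : ℝ} {s₀ : ℂ} {b : ℂ → Fin n → ℂ} {b' : Fin n → ℂ} {A : Fin n → ℂ → 𝔸}
  {L : Fin n → 𝔸} {φ : Fin n → ℂ → ℂ} {f : Fin n → ℂ} {Λ : 𝔸} {ψ : ℂ → ℂ} {g : ℂ} {Y : ℂ → ℂ → 𝔸}

lemma eventually_mem_cutPlane (h : IsScalarDeformation θ s₀ b b' A L φ f Λ ψ g Y) {x : ℂ}
    (hx : x ∈ cutPlane θ (b s₀)) : ∀ᶠ z in 𝓝 (s₀, x), z.2 ∈ cutPlane θ (b z.1) := by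
  have hb : ContinuousAt b s₀ := continuousAt_pi.2 fun j => (h.hasDerivAt_b j).continuousAt
  have hc : ContinuousAt (fun z : ℂ × ℂ => (b z.1, z.2)) (s₀, x) :=
    (hb.comp (f := Prod.fst) (x := (s₀, x)) continuousAt_fst).prodMk continuousAt_snd
  exact hc.eventually ((isOpen_setOf_mem_cutPlane θ n).mem_nhds hx)

lemma eventually_mem_cutPlane_left (h : IsScalarDeformation θ s₀ b b' A L φ f Λ ψ g Y) {x : ℂ}
    (hx : x ∈ cutPlane θ (b s₀)) : ∀ᶠ s in 𝓝 s₀, x ∈ cutPlane θ (b s) := by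
  have hc : ContinuousAt (fun s : ℂ => (s, x)) s₀ := by fun_prop
  exact hc.eventually (h.eventually_mem_cutPlane hx)

end IsScalarDeformation

variable [CompleteSpace 𝔸]

lemma eventually_isUnit_comp {R X : Type*} [NormedRing R] [CompleteSpace R] [TopologicalSpace X]
    {G : X → R} {x : X} (hG : ContinuousAt G x) (hu : IsUnit (G x)) : ∀ᶠ y in 𝓝 x, IsUnit (G y) :=
  hG.eventually (Units.isOpen.mem_nhds hu)

lemma exp_smul_add_smul_one (l c : ℂ) (L : 𝔸) :
    NormedSpace.exp (l • (L + c • (1 : 𝔸))) = Complex.exp (l * c) • NormedSpace.exp (l • L) := by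
  have h1 : l • (L + c • (1 : 𝔸)) = algebraMap ℂ 𝔸 (l * c) + l • L := by
    rw [smul_add, smul_smul, Algebra.algebraMap_eq_smul_one, add_comm]
  have : NormedAlgebra ℚ 𝔸 := NormedAlgebra.restrictScalars ℚ ℂ 𝔸
  rw [h1, NormedSpace.exp_add_of_commute (Algebra.commutes _ _),
    ← NormedSpace.algebraMap_exp_comm, Complex.exp_eq_exp_ℂ, ← Algebra.smul_def]

/-- Derivative of `z ^ (L + φ)` along a curve, where `φ` is scalar: the scalar part of the exponent
contributes `φ' log z`, the base contributes `(z' / z) L`. -/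
lemma hasDerivAt_exp_branchLog_smul {θ : ℝ} {z φ : ℂ → ℂ} {z' φ' s₀ : ℂ} (L : 𝔸)
    (hz : HasDerivAt z z' s₀) (hmem : rot θ * z s₀ ∈ Complex.slitPlane) (hφ₀ : φ s₀ = 0)
    (hφ : HasDerivAt φ φ' s₀) :
    HasDerivAt (fun s => NormedSpace.exp (branchLog θ (z s) • (L + φ s • (1 : 𝔸))))
      (((φ' * branchLog θ (z s₀)) • (1 : 𝔸) + (z' * (z s₀)⁻¹) • L) *
        NormedSpace.exp (branchLog θ (z s₀) • L)) s₀ := by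
  have hl : HasDerivAt (fun s => branchLog θ (z s)) ((z s₀)⁻¹ * z') s₀ :=
    (hasDerivAt_branchLog hmem).comp s₀ hz
  have h1 := (hl.mul hφ).cexp
  have h2 := (hasDerivAt_exp_smul_const' L (branchLog θ (z s₀))).scomp s₀ hl
  have h := h1.smul h2
  refine (h.congr_of_eventuallyEq (Eventually.of_forall fun s =>
    exp_smul_add_smul_one _ _ _)).congr_deriv ?_
  simp only [Function.comp_apply, Pi.mul_apply, hφ₀, mul_zero, Complex.exp_zero, one_smul, one_mul,
    zero_add, add_mul, smul_mul_assoc]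
  rw [add_comm, mul_comm φ', mul_comm z']

lemma isUnit_exp (L : 𝔸) : IsUnit (NormedSpace.exp L) := by
  have : NormedAlgebra ℚ 𝔸 := NormedAlgebra.restrictScalars ℚ ℂ 𝔸
  exact NormedSpace.isUnit_exp L

/-- The residue of a Fuchsian system at a singular point is conjugate to the local exponent. -/
lemma residue_mul_eq {n : ℕ} {θ : ℝ} {a : Fin n → ℂ} (ha : CutsDisjoint θ a) {A : Fin n → 𝔸}
    {Y : ℂ → 𝔸} (hY : ∀ x ∈ cutPlane θ a, HasDerivAt Y ((∑ i, (x - a i)⁻¹ • A i) * Y x) x)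
    (j : Fin n) {G : ℂ → 𝔸} (hG : AnalyticAt ℂ G (a j)) {L : 𝔸}
    (hYG : ∀ᶠ x in 𝓝 (a j), x ∈ cutPlane θ a →
      Y x = G x * NormedSpace.exp (branchLog θ (x - a j) • L)) :
    A j * G (a j) = G (a j) * L := by
  have hne : (𝓝[cutPlane θ a] (a j)).NeBot :=
    mem_closure_iff_nhdsWithin_neBot.1 (dense_cutPlane θ a (a j))
  have hid : Tendsto (fun x : ℂ => x - a j) (𝓝[cutPlane θ a] (a j)) (𝓝 0) := by
    have : ContinuousAt (fun x : ℂ => x - a j) (a j) := by fun_prop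
    simpa using this.tendsto.mono_left nhdsWithin_le_nhds
  have hcoef : ∀ i, Tendsto (fun x => (x - a j) * (x - a i)⁻¹) (𝓝[cutPlane θ a] (a j))
      (𝓝 (if i = j then 1 else 0)) := by
    intro i
    split_ifs with hij
    · subst hij
      refine tendsto_const_nhds.congr' ?_
      filter_upwards [self_mem_nhdsWithin] with x hx
      exact (mul_inv_cancel₀ (sub_ne_zero_of_mem_cutPlane hx i)).symm
    · have h0 := sub_ne_zero_of_cutsDisjoint ha hij
      have : ContinuousAt (fun x : ℂ => (x - a i)⁻¹) (a j) :=
        ContinuousAt.inv₀ (by fun_prop) h0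
      simpa using hid.mul (this.tendsto.mono_left nhdsWithin_le_nhds)
  have hGlim : Tendsto G (𝓝[cutPlane θ a] (a j)) (𝓝 (G (a j))) :=
    hG.continuousAt.tendsto.mono_left nhdsWithin_le_nhds
  have hleft : Tendsto (fun x => (∑ i, ((x - a j) * (x - a i)⁻¹) • A i) * G x)
      (𝓝[cutPlane θ a] (a j)) (𝓝 (A j * G (a j))) := by
    have := (tendsto_finsetSum Finset.univ fun i _ => (hcoef i).smul_const (A i)).mul hGlim
    simpa using this
  have hright : Tendsto (fun x => (x - a j) • deriv G x + G x * L)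
      (𝓝[cutPlane θ a] (a j)) (𝓝 (G (a j) * L)) := by
    have h1 := hid.smul (hG.deriv.continuousAt.tendsto.mono_left nhdsWithin_le_nhds)
    simpa using h1.add (hGlim.mul_const L)
  refine tendsto_nhds_unique hleft (hright.congr' ?_)
  filter_upwards [self_mem_nhdsWithin, eventually_nhdsWithin_of_eventually_nhds
    (hYG.eventually_nhds.and hG.eventually_analyticAt)] with x hx hx2
  obtain ⟨hYx, hGx⟩ := hx2
  have hmem : ∀ᶠ y in 𝓝 x, y ∈ cutPlane θ a := (isOpen_cutPlane θ a).mem_nhds hx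
  have hxj := sub_ne_zero_of_mem_cutPlane hx j
  -- differentiate the local expansion at a nearby point of the cut plane
  have hP := hasDerivAt_exp_branchLog_smul (φ := fun _ => 0) L
    ((hasDerivAt_id x).sub_const (a j)) (mem_cutPlane_iff.1 hx j) rfl (hasDerivAt_const x 0)
  have h1 := (hGx.differentiableAt.hasDerivAt.mul hP).congr_of_eventuallyEq
    (f₁ := Y) (by
      filter_upwards [hYx, hmem] with y hy hym
      simpa using hy hym)
  have h2 := h1.unique (hY x hx)
  rw [hYx.self_of_nhds hx] at h2
  have h3 : (deriv G x + (x - a j)⁻¹ • (G x * L)) * NormedSpace.exp (branchLog θ (x - a j) • L) =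
      ((∑ i, (x - a i)⁻¹ • A i) * G x) * NormedSpace.exp (branchLog θ (x - a j) • L) := by
    rw [mul_assoc (∑ i, _), ← h2]
    simp [add_mul, mul_assoc]
  have h4 := (isUnit_exp (branchLog θ (x - a j) • L)).mul_right_cancel h3
  have h5 := congrArg (fun y => (x - a j) • y) h4
  simp only [smul_add, smul_smul, mul_inv_cancel₀ hxj, one_smul] at h5
  rw [h5, ← smul_mul_assoc, Finset.smul_sum]
  simp only [smul_smul]

/-- The partial derivative in the first variable of an analytic function is analytic in the second
variable. -/
lemma exists_partialDeriv_fst {G : ℂ × ℂ → 𝔸} {s₀ x₀ : ℂ} (hG : AnalyticAt ℂ G (s₀, x₀)) :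
    ∃ G' : ℂ → 𝔸, AnalyticAt ℂ G' x₀ ∧
      ∀ᶠ x in 𝓝 x₀, HasDerivAt (fun s => G (s, x)) (G' x) s₀ := by
  refine ⟨fun x => fderiv ℂ G (s₀, x) (1, 0), ?_, ?_⟩
  · have h1 : AnalyticAt ℂ (fun x : ℂ => (s₀, x)) x₀ := analyticAt_const.prod analyticAt_id
    have h2 : AnalyticAt ℂ (fun x : ℂ => fderiv ℂ G (s₀, x)) x₀ :=
      AnalyticAt.fun_comp (g := fderiv ℂ G) hG.fderiv h1
    exact ((ContinuousLinearMap.apply ℂ 𝔸 ((1, 0) : ℂ × ℂ)).analyticAt _).fun_comp h2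
  · have hc : ContinuousAt (fun x : ℂ => (s₀, x)) x₀ := by fun_prop
    filter_upwards [hc.eventually hG.eventually_analyticAt] with x hx
    have h1 : HasDerivAt (fun s : ℂ => (s, x)) ((1, 0) : ℂ × ℂ) s₀ :=
      (hasDerivAt_id s₀).prodMk (hasDerivAt_const s₀ x)
    exact HasFDerivAt.comp_hasDerivAt s₀ (f := fun s : ℂ => (s, x))
      hx.differentiableAt.hasFDerivAt h1

lemma analyticAt_ringInverse_comp {E : Type*} [NormedAddCommGroup E] [NormedSpace ℂ E] {G : E → 𝔸}
    {x : E} (hG : AnalyticAt ℂ G x) (hu : IsUnit (G x)) :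
    AnalyticAt ℂ (fun y => Ring.inverse (G y)) x := by
  obtain ⟨u, hu⟩ := hu
  exact AnalyticAt.fun_comp (g := Ring.inverse) (hu ▸ analyticAt_inverse u) hG

namespace IsScalarDeformation

variable {n : ℕ} {θ : ℝ} {s₀ : ℂ} {b : ℂ → Fin n → ℂ} {b' : Fin n → ℂ} {A : Fin n → ℂ → 𝔸}
  {L : Fin n → 𝔸} {φ : Fin n → ℂ → ℂ} {f : Fin n → ℂ} {Λ : 𝔸} {ψ : ℂ → ℂ} {g : ℂ} {Y : ℂ → ℂ → 𝔸}

/-- The residues `A j` are differentiable in the parameter, because they are conjugate to the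
exponents by the leading coefficients of the local expansions. -/
lemma exists_hasDerivAt_residue (h : IsScalarDeformation θ s₀ b b' A L φ f Λ ψ g Y) (j : Fin n) :
    ∃ A' : 𝔸, HasDerivAt (A j) A' s₀ := by
  obtain ⟨G, hG, hGu, hYG⟩ := h.local_expansion j
  have hbc : ContinuousAt (fun s => (s, b s j)) s₀ :=
    continuousAt_id.prodMk (h.hasDerivAt_b j).continuousAt
  have hev : ∀ᶠ s in 𝓝 s₀, A j s =
      G (s, b s j) * (L j + φ j s • (1 : 𝔸)) * Ring.inverse (G (s, b s j)) := by
    filter_upwards [h.cutsDisjoint, h.hasDerivAt, hbc.eventually hYG.eventually_nhds,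
      hbc.eventually hG.eventually_analyticAt,
      hbc.eventually (eventually_isUnit_comp hG.continuousAt hGu)] with s hs1 hs2 hs3 hs4 hs5
    have hc : ContinuousAt (fun x : ℂ => (s, x)) (b s j) := by fun_prop
    have := residue_mul_eq hs1 hs2 j (G := fun x => G (s, x))
      (hs4.fun_comp (f := fun x : ℂ => (s, x)) (analyticAt_const.prod analyticAt_id))
      (L := L j + φ j s • (1 : 𝔸)) (hc.eventually hs3)
    rw [← this, mul_assoc, Ring.mul_inverse_cancel _ hs5, mul_one]
  have hd : HasDerivAt (fun s => (s, b s j)) (1, b' j) s₀ :=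
    (hasDerivAt_id s₀).prodMk (h.hasDerivAt_b j)
  have h1 := HasFDerivAt.comp_hasDerivAt s₀ (f := fun s => (s, b s j))
    hG.differentiableAt.hasFDerivAt hd
  have h2 := HasFDerivAt.comp_hasDerivAt s₀ (f := fun s => (s, b s j))
    (analyticAt_ringInverse_comp hG hGu).differentiableAt.hasFDerivAt hd
  have h3 := ((h.hasDerivAt_φ j).smul_const (1 : 𝔸)).const_add (L j)
  exact ⟨_, ((h1.mul h3).mul h2).congr_of_eventuallyEq hev⟩

/-- Near a singular point, `(∂Y/∂s) Y⁻¹` is the sum of a holomorphic term, the logarithm that comes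
from the change of the exponent, and a pole that comes from the motion of the singular point. -/
lemma exists_hasDerivAt_near_pole (h : IsScalarDeformation θ s₀ b b' A L φ f Λ ψ g Y)
    (j : Fin n) : ∃ G G' : ℂ → 𝔸, AnalyticAt ℂ G (b s₀ j) ∧ AnalyticAt ℂ G' (b s₀ j) ∧
      IsUnit (G (b s₀ j)) ∧ A j s₀ * G (b s₀ j) = G (b s₀ j) * L j ∧
      ∀ᶠ x in 𝓝 (b s₀ j), x ∈ cutPlane θ (b s₀) → HasDerivAt (fun s => Y s x)
        ((G' x * Ring.inverse (G x) + (f j * branchLog θ (x - b s₀ j)) • (1 : 𝔸) -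
          (b' j * (x - b s₀ j)⁻¹) • (G x * L j * Ring.inverse (G x))) * Y s₀ x) s₀ := by
  obtain ⟨G, hG, hGu, hYG⟩ := h.local_expansion j
  obtain ⟨G', hG', hGG'⟩ := exists_partialDeriv_fst hG
  have hG0 : AnalyticAt ℂ (fun x => G (s₀, x)) (b s₀ j) :=
    AnalyticAt.fun_comp (g := G) (f := fun x : ℂ => (s₀, x)) hG (analyticAt_const.prod analyticAt_id)
  have hc : ∀ y, ContinuousAt (fun x : ℂ => (s₀, x)) y := fun y => by fun_prop
  have hYG0 := (hc _).eventually hYG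
  refine ⟨fun x => G (s₀, x), G', hG0, hG', hGu, ?_, ?_⟩
  · refine residue_mul_eq h.cutsDisjoint.self_of_nhds h.hasDerivAt.self_of_nhds j hG0 ?_
    simpa [h.φ_eq_zero] using hYG0
  · filter_upwards [(hc _).eventually hYG.eventually_nhds, hGG',
      eventually_isUnit_comp hG0.continuousAt hGu] with x hx hGx hxu hxD
    have hcs : ContinuousAt (fun s : ℂ => (s, x)) s₀ := by fun_prop
    have hmem : rot θ * (x - b s₀ j) ∈ Complex.slitPlane := mem_cutPlane_iff.1 hxD j
    have hP := hasDerivAt_exp_branchLog_smul (L j) ((h.hasDerivAt_b j).const_sub x) hmem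
      (h.φ_eq_zero j) (h.hasDerivAt_φ j)
    refine ((hGx.mul hP).congr_of_eventuallyEq (f₁ := fun s => Y s x) ?_).congr_deriv ?_
    · filter_upwards [hcs.eventually hx, h.eventually_mem_cutPlane_left hxD] with s hs hsD
      exact hs hsD
    · have hY0 := hx.self_of_nhds hxD
      simp only [h.φ_eq_zero, zero_smul, add_zero] at hY0 ⊢
      rw [hY0]
      have hi : ∀ X : 𝔸, Ring.inverse (G (s₀, x)) * (G (s₀, x) * X) = X := fun X => by
        rw [← mul_assoc, Ring.inverse_mul_cancel _ hxu, one_mul]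
      simp only [add_mul, sub_mul, mul_add, smul_mul_assoc, mul_smul_comm, mul_assoc, hi, one_mul,
        neg_mul, neg_smul, mul_neg]
      abel

/-- On a half plane, `(∂Y/∂s) Y⁻¹` is holomorphic in `1/x` up to a multiple of `log x`. -/
lemma exists_hasDerivAt_near_infty (h : IsScalarDeformation θ s₀ b b' A L φ f Λ ψ g Y) :
    ∃ J : ℂ → 𝔸, AnalyticAt ℂ J 0 ∧ J 0 = 0 ∧ ∃ R : ℝ, 0 < R ∧
      ∀ x, R < (rot θ * x).re → HasDerivAt (fun s => Y s x)
        ((J x⁻¹ + (g * branchLog θ x) • (1 : 𝔸)) * Y s₀ x) s₀ := by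
  obtain ⟨H, hH, hH1, R, hYH⟩ := h.expansion_infty
  obtain ⟨H', hH', hHH'⟩ := exists_partialDeriv_fst hH
  have hH0 : AnalyticAt ℂ (fun w => H (s₀, w)) 0 :=
    AnalyticAt.fun_comp (g := H) (f := fun x : ℂ => (s₀, x)) hH (analyticAt_const.prod analyticAt_id)
  have hu : IsUnit (H (s₀, 0)) := by rw [hH1.self_of_nhds]; exact isUnit_one
  have hH'0 : H' 0 = 0 := (hHH'.self_of_nhds).unique
    ((hasDerivAt_const s₀ (1 : 𝔸)).congr_of_eventuallyEq hH1)
  obtain ⟨ρ, hρ, hw⟩ := Metric.eventually_nhds_iff.1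
    (hHH'.and (eventually_isUnit_comp hH0.continuousAt hu))
  refine ⟨fun w => H' w * Ring.inverse (H (s₀, w)), hH'.mul (analyticAt_ringInverse_comp hH0 hu),
    by simp [hH'0], max R ρ⁻¹, lt_max_of_lt_right (inv_pos.2 hρ), fun x hx => ?_⟩
  obtain ⟨hx1, hx2⟩ := max_lt_iff.1 hx
  have hmem : rot θ * x ∈ Complex.slitPlane := Or.inl ((inv_pos.2 hρ).trans hx2)
  have hnorm : ρ⁻¹ < ‖x‖ := by
    refine hx2.trans_le ((Complex.re_le_norm _).trans ?_)
    rw [norm_mul, norm_rot, one_mul]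
  obtain ⟨hd, hxu⟩ := hw (y := x⁻¹) (by
    rw [dist_zero_right, norm_inv]
    exact inv_lt_of_inv_lt₀ hρ hnorm)
  have hP := hasDerivAt_exp_branchLog_smul Λ (hasDerivAt_const s₀ x) hmem h.ψ_eq_zero
    h.hasDerivAt_ψ
  refine ((hd.mul hP).congr_of_eventuallyEq (f₁ := fun s => Y s x) ?_).congr_deriv ?_
  · filter_upwards [hYH] with s hs using hs x hx1
  · have hY0 := hYH.self_of_nhds x hx1
    simp only [h.ψ_eq_zero, zero_smul, add_zero] at hY0 ⊢
    rw [hY0]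
    have hi : ∀ X : 𝔸, Ring.inverse (H (s₀, x⁻¹)) * (H (s₀, x⁻¹) * X) = X := fun X => by
      rw [← mul_assoc, Ring.inverse_mul_cancel _ hxu, one_mul]
    simp only [add_mul, smul_mul_assoc, mul_smul_comm, mul_assoc, hi, one_mul, zero_mul,
      zero_smul, add_zero]

end IsScalarDeformation

end ScalarDeformation

/-! ### Continuation across a cut -/

/-- A solution on the cut plane of a linear equation that is holomorphic off the singular points
continues analytically across a cut, if it does so near the end point of the cut: a solution on a
convex neighbourhood of a piece of the cut that agrees with the given one near the end point agrees
with it on both sides of the cut. -/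
lemma exists_continuation_across_cut {E : Type*} [NormedAddCommGroup E] [NormedSpace ℂ E]
    [CompleteSpace E] {n : ℕ} {θ : ℝ} {a : Fin n → ℂ} (ha : CutsDisjoint θ a)
    {T : ℂ → E →L[ℂ] E} {R : ℂ → E} (hT : DifferentiableOn ℂ T {x | ∀ i, x - a i ≠ 0})
    (hR : DifferentiableOn ℂ R {x | ∀ i, x - a i ≠ 0}) {u : ℂ → E}
    (hu : ∀ x ∈ cutPlane θ a, HasDerivAt u (T x (u x) + R x) x) (j : Fin n) {e : ℂ → E}
    (he : AnalyticAt ℂ e (a j)) (hue : ∀ᶠ y in 𝓝 (a j), y ∈ cutPlane θ a → u y = e y) {x : ℂ}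
    (hx : (rot θ * (x - a j)).im = 0) (hx' : (rot θ * (x - a j)).re < 0) :
    ∃ e' : ℂ → E, AnalyticAt ℂ e' x ∧ ∀ᶠ y in 𝓝 x, y ∈ cutPlane θ a → u y = e' y := by
  have hr0 := rot_ne_zero θ
  obtain ⟨r, hr, hball⟩ := Metric.eventually_nhds_iff_ball.1 (he.eventually_analyticAt.and hue)
  -- a neighbourhood of the cut that avoids the other cuts
  let W : Set ℂ := {y | (rot θ * (y - a j)).re < 0 ∧ ∀ i, i ≠ j → (rot θ * (y - a i)).im ≠ 0}
  have hWo : IsOpen W := by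
    have h1 : IsOpen {y | (rot θ * (y - a j)).re < 0} :=
      isOpen_lt (Complex.continuous_re.comp (by fun_prop)) continuous_const
    have h2 : IsOpen {y | ∀ i, i ≠ j → (rot θ * (y - a i)).im ≠ 0} := by
      simp only [ofPred_forall]
      refine isOpen_iInter_of_finite fun i => isOpen_iInter_of_finite fun _ => ?_
      exact isOpen_ne_fun (Complex.continuous_im.comp (by fun_prop)) continuous_const
    exact h1.inter h2
  have hWs : W ⊆ {x | ∀ i, x - a i ≠ 0} := by
    rintro y ⟨hy1, hy2⟩ i hi
    by_cases hij : i = j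
    · subst hij; simp [hi] at hy1
    · exact hy2 i hij (by simp [hi])
  -- a point of the cut that is close to its end point
  obtain ⟨τ, hτ0, hτ1, hτr⟩ : ∃ τ : ℝ, 0 < τ ∧ τ ≤ 1 ∧
      a j + τ * (x - a j) ∈ Metric.ball (a j) r := by
    have hc : Tendsto (fun τ : ℝ => a j + τ * (x - a j)) (𝓝[>] 0) (𝓝 (a j)) := by
      have : ContinuousAt (fun τ : ℝ => a j + τ * (x - a j)) 0 := by fun_prop
      simpa using this.tendsto.mono_left nhdsWithin_le_nhds
    have h1 : ∀ᶠ τ : ℝ in 𝓝[>] 0, τ ≤ 1 :=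
      nhdsWithin_le_nhds (Iic_mem_nhds zero_lt_one)
    obtain ⟨τ, h⟩ := (((hc.eventually (Metric.ball_mem_nhds _ hr)).and h1).and
      self_mem_nhdsWithin).exists
    exact ⟨τ, h.2, h.1.2, h.1.1⟩
  set x₁ : ℂ := a j + τ * (x - a j) with hx₁
  have hcut : ∀ t : ℝ, 0 < t → a j + t * (x - a j) ∈ W := by
    intro t ht
    have h1 : rot θ * (a j + t * (x - a j) - a j) = t * (rot θ * (x - a j)) := by ring
    refine ⟨?_, fun i hij => ?_⟩
    · rw [h1, Complex.re_ofReal_mul]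
      exact mul_neg_of_pos_of_neg ht hx'
    · have h2 : rot θ * (a j + t * (x - a j) - a i) =
          t * (rot θ * (x - a j)) + rot θ * (a j - a i) := by ring
      rw [h2, Complex.add_im, Complex.im_ofReal_mul, hx, mul_zero, zero_add]
      exact rot_mul_im_ne_zero_of_cutsDisjoint ha hij
  have hseg : segment ℝ x₁ x ⊆ W := by
    rw [segment_eq_image']
    rintro _ ⟨t, ht, rfl⟩
    have hpos : 0 < τ + t * (1 - τ) := by
      have := mul_nonneg ht.1 (sub_nonneg.2 hτ1)
      linarith
    convert hcut _ hpos using 1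
    simp only [hx₁, Complex.real_smul]
    push_cast
    ring
  obtain ⟨Ω, hΩo, hΩc, hsegΩ, hΩW, w, hw₁, hw⟩ := exists_linearODE_solution_near_segment hWo
    (hT.mono hWs) (hR.mono hWs) hseg (e x₁)
  have hx₁Ω : x₁ ∈ Ω := hsegΩ (left_mem_segment ℝ x₁ x)
  have hTΩ : ContinuousOn T Ω := hT.continuousOn.mono (hΩW.trans hWs)
  have hRΩ : ContinuousOn R Ω := hR.continuousOn.mono (hΩW.trans hWs)
  -- the continuation near the end point solves the equation, by continuity
  have heODE : ∀ y ∈ Metric.ball (a j) r ∩ Ω, HasDerivAt e (T y (e y) + R y) y := by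
    rintro y ⟨hyb, hyΩ⟩
    have hya := (hball y hyb).1
    have hne : (𝓝[cutPlane θ a] y).NeBot :=
      mem_closure_iff_nhdsWithin_neBot.1 (dense_cutPlane θ a y)
    have h1 : Tendsto (deriv e) (𝓝[cutPlane θ a] y) (𝓝 (deriv e y)) :=
      hya.deriv.continuousAt.tendsto.mono_left nhdsWithin_le_nhds
    have h2 : Tendsto (fun z => T z (e z) + R z) (𝓝[cutPlane θ a] y) (𝓝 (T y (e y) + R y)) :=
      (((hTΩ.continuousAt (hΩo.mem_nhds hyΩ)).clm_apply hya.continuousAt).add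
        (hRΩ.continuousAt (hΩo.mem_nhds hyΩ))).tendsto.mono_left nhdsWithin_le_nhds
    have h3 : T y (e y) + R y = deriv e y := by
      refine tendsto_nhds_unique h2 (h1.congr' ?_)
      filter_upwards [self_mem_nhdsWithin,
        nhdsWithin_le_nhds (Metric.isOpen_ball.mem_nhds hyb)] with z hzD hzb
      have : u =ᶠ[𝓝 z] e := by
        filter_upwards [(isOpen_cutPlane θ a).mem_nhds hzD, Metric.isOpen_ball.mem_nhds hzb] with v
          hvD hvb using (hball v hvb).2 hvD
      rw [← this.deriv_eq, (hu z hzD).deriv, this.self_of_nhds]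
    rw [h3]
    exact hya.differentiableAt.hasDerivAt
  have hew : ∀ y ∈ Metric.ball (a j) r ∩ Ω, e y = w y :=
    linearODE_solution_unique ((convex_ball _ _).inter hΩc) (hTΩ.mono inter_subset_right) heODE
      (fun y hy => hw y hy.2) ⟨hτr, hx₁Ω⟩ hw₁.symm
  have hΩD : ∀ y ∈ Ω, (rot θ * (y - a j)).im ≠ 0 → y ∈ cutPlane θ a := by
    intro y hy hyj
    refine mem_cutPlane_of_im_ne_zero fun i => ?_
    by_cases hij : i = j
    · rwa [hij]
    · exact (hΩW hy).2 i hij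
  -- uniqueness on each side of the cut
  have hside : ∀ σ : ℝ, σ * σ = 1 → ∀ y ∈ Ω, 0 < σ * (rot θ * (y - a j)).im → u y = w y := by
    intro σ hσ y hy hyσ
    let Ωσ : Set ℂ := Ω ∩ {y | 0 < σ * (rot θ * (y - a j)).im}
    have hne : ∀ z ∈ Ωσ, z ∈ cutPlane θ a := by
      rintro z ⟨hz, hz'⟩
      refine hΩD z hz fun h0 => ?_
      rw [mem_ofPred_eq, h0, mul_zero] at hz'
      exact hz'.false
    have hconv : Convex ℝ Ωσ := by
      refine hΩc.inter ?_
      intro z hz v hv p q hp hq hpq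
      have h1 : rot θ * (p • z + q • v - a j) =
          p * (rot θ * (z - a j)) + q * (rot θ * (v - a j)) := by
        have : (p : ℂ) + q = 1 := by exact_mod_cast hpq
        simp only [Complex.real_smul]
        linear_combination (rot θ * a j) * this
      simp only [mem_ofPred_eq] at hz hv ⊢
      rw [h1, Complex.add_im, Complex.im_ofReal_mul, Complex.im_ofReal_mul]
      rcases hp.eq_or_lt with h0 | h0
      · have : q = 1 := by linarith
        rw [← h0, this]; simpa using hv
      · have := mul_pos h0 hz
        have := mul_nonneg hq hv.le
        nlinarith
    obtain ⟨z, hzb, hzσ⟩ : ∃ z, z ∈ Metric.ball (a j) r ∩ Ω ∧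
        0 < σ * (rot θ * (z - a j)).im := by
      have hc : Tendsto (fun t : ℝ => x₁ + (rot θ)⁻¹ * ((t * σ : ℝ) * Complex.I)) (𝓝[>] 0)
          (𝓝 x₁) := by
        have : ContinuousAt (fun t : ℝ => x₁ + (rot θ)⁻¹ * ((t * σ : ℝ) * Complex.I)) 0 := by
          fun_prop
        simpa using this.tendsto.mono_left nhdsWithin_le_nhds
      obtain ⟨t, ht, ht0⟩ := ((hc.eventually ((Metric.isOpen_ball.inter hΩo).mem_nhds
        ⟨hτr, hx₁Ω⟩)).and self_mem_nhdsWithin).exists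
      refine ⟨_, ht, ?_⟩
      have h1 : rot θ * (x₁ + (rot θ)⁻¹ * ((t * σ : ℝ) * Complex.I) - a j) =
          τ * (rot θ * (x - a j)) + (t * σ : ℝ) * Complex.I := by
        rw [hx₁]; field_simp; ring
      rw [h1, Complex.add_im, Complex.im_ofReal_mul, hx, Complex.im_ofReal_mul, Complex.I_im,
        mul_zero, zero_add, mul_one, mul_comm t, ← mul_assoc, hσ, one_mul]
      exact ht0
    refine linearODE_solution_unique hconv (hTΩ.mono inter_subset_left)
      (fun z hz => hu z (hne z hz)) (fun z hz => hw z hz.1) (x₀ := z) ⟨hzb.2, hzσ⟩ ?_ y ⟨hy, hyσ⟩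
    rw [(hball z hzb.1).2 (hne z ⟨hzb.2, hzσ⟩), hew z hzb]
  refine ⟨w, ?_, ?_⟩
  · have hwd : DifferentiableOn ℂ w Ω := fun y hy =>
      (hw y hy).differentiableAt.differentiableWithinAt
    exact hwd.analyticAt (hΩo.mem_nhds (hsegΩ (right_mem_segment ℝ x₁ x)))
  · filter_upwards [hΩo.mem_nhds (hsegΩ (right_mem_segment ℝ x₁ x))] with y hy hyD
    rcases lt_trichotomy (rot θ * (y - a j)).im 0 with h | h | h
    · exact hside (-1) (by norm_num) y hy (by linarith)
    · rcases Complex.mem_slitPlane_iff.1 (mem_cutPlane_iff.1 hyD j) with h' | h'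
      · exact absurd (hΩW hy).1 (not_lt.2 h'.le)
      · exact absurd h h'
    · exact hside 1 (by norm_num) y hy (by linarith)

/-! ### The defect of the deformation equation -/

namespace IsScalarDeformation

variable {𝔸 : Type*} [NormedRing 𝔸] [NormedAlgebra ℂ 𝔸]
  {n : ℕ} {θ : ℝ} {s₀ : ℂ} {b : ℂ → Fin n → ℂ} {b' : Fin n → ℂ} {A : Fin n → ℂ → 𝔸}
  {L : Fin n → 𝔸} {φ : Fin n → ℂ → ℂ} {f : Fin n → ℂ} {Λ : 𝔸} {ψ : ℂ → ℂ} {g : ℂ} {Y : ℂ → ℂ → 𝔸}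

variable [CompleteSpace 𝔸]

/-- `∂Y/∂s` exists on the whole cut plane and is a holomorphic solution of the variational equation:
this holds on a half plane by the expansion at infinity, and is carried along rays parallel to the
cuts. -/
lemma exists_variation (h : IsScalarDeformation θ s₀ b b' A L φ f Λ ψ g Y) {A' : Fin n → 𝔸}
    (hA : ∀ i, HasDerivAt (A i) (A' i) s₀) {x : ℂ} (hx : x ∈ cutPlane θ (b s₀)) :
    ∃ V : ℂ → 𝔸, (∀ᶠ y in 𝓝 x, HasDerivAt (fun s => Y s y) (V y) s₀) ∧
      HasDerivAt V ((∑ i, (x - b s₀ i)⁻¹ • A i s₀) * V x +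
        (∑ i, ((x - b s₀ i)⁻¹ • A' i + (b' i * ((x - b s₀ i)⁻¹) ^ 2) • A i s₀)) * Y s₀ x) x := by
  obtain ⟨J, -, -, R, -, hJ⟩ := h.exists_hasDerivAt_near_infty
  set D := cutPlane θ (b s₀) with hD
  have hDo : IsOpen D := isOpen_cutPlane θ (b s₀)
  -- a point of the half plane on the ray from `x`
  set t : ℝ := max 0 (R + 1 - (rot θ * x).re)
  have ht0 : 0 ≤ t := le_max_left _ _
  set x₁ : ℂ := x + t * (rot θ)⁻¹ with hx₁
  have hx₁R : R < (rot θ * x₁).re := by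
    have h1 : rot θ * x₁ = rot θ * x + t := by
      have := rot_ne_zero θ
      rw [hx₁]; field_simp
    rw [h1, Complex.add_re, Complex.ofReal_re]
    have : R + 1 - (rot θ * x).re ≤ t := le_max_right _ _
    linarith
  set M : ℂ → 𝔸 := fun y => ∑ i, (y - b s₀ i)⁻¹ • A i s₀ with hM
  set M' : ℂ → 𝔸 := fun y =>
    ∑ i, ((y - b s₀ i)⁻¹ • A' i + (b' i * ((y - b s₀ i)⁻¹) ^ 2) • A i s₀) with hM'
  have hMd : DifferentiableOn ℂ M D := by
    have := (differentiableOn_sum_pole (a := b s₀) (c := fun _ => 1) 1 fun i => A i s₀).mono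
      (cutPlane_subset (θ := θ))
    simpa using this
  have hM'd : DifferentiableOn ℂ M' D := by
    have h1 := (differentiableOn_sum_pole (a := b s₀) (c := fun _ => 1) 1 A').mono
      (cutPlane_subset (θ := θ))
    have h2 := (differentiableOn_sum_pole (a := b s₀) (c := b') 2 fun i => A i s₀).mono
      (cutPlane_subset (θ := θ))
    have h3 := h1.add h2
    simp only [pow_one, one_mul] at h3
    refine h3.congr fun y _ => ?_
    simp [hM', Finset.sum_add_distrib]
  have hY₀ := h.hasDerivAt.self_of_nhds
  have hYd : DifferentiableOn ℂ (Y s₀) D := fun y hy =>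
    (hY₀ y hy).differentiableAt.differentiableWithinAt
  obtain ⟨Ω, hΩo, hΩc, hsegΩ, hΩD, V, hV₁, hV⟩ := exists_linearODE_solution_near_segment hDo
    (T := fun y => ContinuousLinearMap.mul ℂ 𝔸 (M y)) (R := fun y => M' y * Y s₀ y)
    ((ContinuousLinearMap.mul ℂ 𝔸).differentiable.comp_differentiableOn hMd) (hM'd.mul hYd)
    (segment_ray_subset_cutPlane hx ht0)
    ((J x₁⁻¹ + (g * branchLog θ x₁) • (1 : 𝔸)) * Y s₀ x₁)
  have hxΩ : x ∈ Ω := hsegΩ (right_mem_segment ℝ x₁ x)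
  have hx₁Ω : x₁ ∈ Ω := hsegΩ (left_mem_segment ℝ x₁ x)
  refine ⟨V, ?_, hV x hxΩ⟩
  filter_upwards [hΩo.mem_nhds hxΩ] with y hy
  have hsub : segment ℝ x₁ y ⊆ Ω := hΩc.segment_subset hx₁Ω hy
  have hcomp : IsCompact (segment ℝ x₁ y) := isCompact_segment _ _
  refine hasDerivAt_param_of_linearODE (M := fun s z => ∑ i, (z - b s i)⁻¹ • A i s) (M' := M')
    (x₀ := x₁) ?_ (fun z hz => hV z (hsub hz)) ?_
    (hMd.continuousOn.mono (hsub.trans hΩD)) (hM'd.continuousOn.mono (hsub.trans hΩD)) ?_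
  · have hev : ∀ᶠ s in 𝓝 s₀, ∀ z ∈ segment ℝ x₁ y, z ∈ cutPlane θ (b s) :=
      hcomp.eventually_forall_of_forall_eventually fun z hz =>
        h.eventually_mem_cutPlane (hΩD (hsub hz))
    filter_upwards [h.hasDerivAt, hev] with s hs hs' z hz using hs z (hs' z hz)
  · have h1 := Asymptotics.IsLittleO.sum (s := Finset.univ) fun i _ =>
      isLittleO_pole_param (hA i) (h.hasDerivAt_b i) hcomp fun hi =>
        sub_ne_zero_of_mem_cutPlane (hΩD (hsub hi)) i (sub_self _)
    refine h1.congr_left fun p => ?_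
    simp only [hM', Finset.smul_sum, Finset.sum_apply, Finset.sum_sub_distrib]
  · rw [hV₁]
    exact hJ x₁ hx₁R

/-- The difference of the two sides of the deformation equation: `(∂Y/∂s) Y⁻¹` minus its expected
value. -/
noncomputable def defect (θ : ℝ) (s₀ : ℂ) (b : ℂ → Fin n → ℂ) (b' : Fin n → ℂ)
    (A : Fin n → ℂ → 𝔸) (f : Fin n → ℂ) (Y : ℂ → ℂ → 𝔸) (x : ℂ) : 𝔸 :=
  deriv (fun s => Y s x) s₀ * Ring.inverse (Y s₀ x) + ∑ i, ((b' i * (x - b s₀ i)⁻¹) • A i s₀ -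
    (f i * branchLog θ (x - b s₀ i)) • (1 : 𝔸))

/-- The defect satisfies `E' = [M, E] + R`, where `M` is the coefficient of the Fuchsian system and
`R` is rational. -/
lemma exists_defect_linearODE (h : IsScalarDeformation θ s₀ b b' A L φ f Λ ψ g Y) :
    ∃ (T : ℂ → 𝔸 →L[ℂ] 𝔸) (R : ℂ → 𝔸), DifferentiableOn ℂ T {x | ∀ i, x - b s₀ i ≠ 0} ∧
      DifferentiableOn ℂ R {x | ∀ i, x - b s₀ i ≠ 0} ∧ ∀ x ∈ cutPlane θ (b s₀),
        HasDerivAt (defect θ s₀ b b' A f Y) (T x (defect θ s₀ b b' A f Y x) + R x) x := by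
  choose A' hA using h.exists_hasDerivAt_residue
  set M : ℂ → 𝔸 := fun y => ∑ i, (y - b s₀ i)⁻¹ • A i s₀ with hM
  set M' : ℂ → 𝔸 := fun y =>
    ∑ i, ((y - b s₀ i)⁻¹ • A' i + (b' i * ((y - b s₀ i)⁻¹) ^ 2) • A i s₀) with hM'
  set S : ℂ → 𝔸 := fun y => ∑ i, (b' i * (y - b s₀ i)⁻¹) • A i s₀ with hS
  set S' : ℂ → 𝔸 := fun y => ∑ i, (-(b' i * ((y - b s₀ i)⁻¹) ^ 2) • A i s₀ -
    (f i * (y - b s₀ i)⁻¹) • (1 : 𝔸)) with hS'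
  have hMd : DifferentiableOn ℂ M {x | ∀ i, x - b s₀ i ≠ 0} := by
    simpa using differentiableOn_sum_pole (a := b s₀) (c := fun _ => 1) 1 fun i => A i s₀
  have hSd : DifferentiableOn ℂ S {x | ∀ i, x - b s₀ i ≠ 0} := by
    simpa using differentiableOn_sum_pole (a := b s₀) (c := b') 1 fun i => A i s₀
  have hM'd : DifferentiableOn ℂ M' {x | ∀ i, x - b s₀ i ≠ 0} := by
    have h1 := differentiableOn_sum_pole (a := b s₀) (c := fun _ => 1) 1 A'
    have h2 := differentiableOn_sum_pole (a := b s₀) (c := b') 2 fun i => A i s₀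
    refine (h1.add h2).congr fun y _ => ?_
    simp [hM', Finset.sum_add_distrib]
  have hS'd : DifferentiableOn ℂ S' {x | ∀ i, x - b s₀ i ≠ 0} := by
    have h1 := differentiableOn_sum_pole (a := b s₀) (c := fun i => -b' i) 2 fun i => A i s₀
    have h2 := differentiableOn_sum_pole (a := b s₀) (c := f) 1 fun _ => (1 : 𝔸)
    refine (h1.sub h2).congr fun y _ => ?_
    simp [hS', Finset.sum_sub_distrib]
  refine ⟨fun x => ContinuousLinearMap.mul ℂ 𝔸 (M x) - (ContinuousLinearMap.mul ℂ 𝔸).flip (M x),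
    fun x => M' x + S' x - (M x * S x - S x * M x), ?_, ?_, fun x hx => ?_⟩
  · exact ((ContinuousLinearMap.mul ℂ 𝔸).differentiable.comp_differentiableOn hMd).sub
      ((ContinuousLinearMap.mul ℂ 𝔸).flip.differentiable.comp_differentiableOn hMd)
  · exact (hM'd.add hS'd).sub ((hMd.mul hSd).sub (hSd.mul hMd))
  obtain ⟨V, hV, hVd⟩ := h.exists_variation hA hx
  obtain ⟨y₀, hy₀⟩ := h.isUnit x hx
  have hinv : HasDerivAt (fun y => Ring.inverse (Y s₀ y)) (-(Ring.inverse (Y s₀ x) * M x)) x := by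
    have h1 := HasFDerivAt.comp_hasDerivAt x (f := Y s₀) (l := Ring.inverse)
      (hy₀ ▸ hasFDerivAt_ringInverse y₀) (h.hasDerivAt.self_of_nhds x hx)
    refine h1.congr_deriv ?_
    simp [← hy₀, mul_assoc, hM]
  have hSum : HasDerivAt (fun y => ∑ i, ((b' i * (y - b s₀ i)⁻¹) • A i s₀ -
      (f i * branchLog θ (y - b s₀ i)) • (1 : 𝔸))) (S' x) x := by
    refine HasDerivAt.fun_sum fun i _ => ?_
    have h1 := ((hasDerivAt_inv_sub (sub_ne_zero_of_mem_cutPlane hx i)).const_mul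
      (b' i)).smul_const (A i s₀)
    have h2 := ((hasDerivAt_branchLog_sub hx i).const_mul (f i)).smul_const (1 : 𝔸)
    refine (h1.sub h2).congr_deriv ?_
    simp
  have hE : HasDerivAt (defect θ s₀ b b' A f Y) _ x :=
    ((hVd.mul hinv).add hSum).congr_of_eventuallyEq (by
      filter_upwards [hV] with y hy
      simp [defect, hy.deriv])
  refine hE.congr_deriv ?_
  have hcomm : M x * defect θ s₀ b b' A f Y x - defect θ s₀ b b' A f Y x * M x =
      M x * (V x * Ring.inverse (Y s₀ x)) - V x * Ring.inverse (Y s₀ x) * M x +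
        (M x * S x - S x * M x) := by
    simp only [defect, hV.self_of_nhds.deriv, Finset.sum_sub_distrib, ← Finset.sum_smul, mul_add,
      add_mul, mul_sub, sub_mul, smul_mul_assoc, mul_smul_comm, mul_one, one_mul]
    simp only [hS]
    abel
  have hYi : Y s₀ x * Ring.inverse (Y s₀ x) = 1 := Ring.mul_inverse_cancel _ (h.isUnit x hx)
  simp only [sub_apply, ContinuousLinearMap.mul_apply',
    ContinuousLinearMap.flip_apply]
  rw [hcomm]
  change (M x * V x + M' x * Y s₀ x) * Ring.inverse (Y s₀ x) + _ + S' x = _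
  rw [add_mul, mul_assoc (M' x), hYi, mul_one, mul_neg, mul_assoc, mul_assoc]
  abel

/-- The defect continues analytically to a neighbourhood of every singular point: logarithms and
poles cancel. -/
lemma exists_defect_continuation_at_pole (h : IsScalarDeformation θ s₀ b b' A L φ f Λ ψ g Y)
    (j : Fin n) : ∃ e : ℂ → 𝔸, AnalyticAt ℂ e (b s₀ j) ∧ ∀ᶠ x in 𝓝 (b s₀ j),
      x ∈ cutPlane θ (b s₀) → defect θ s₀ b b' A f Y x = e x := by
  obtain ⟨G, G', hG, hG', hGu, hAG, hder⟩ := h.exists_hasDerivAt_near_pole j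
  have hGi := analyticAt_ringInverse_comp hG hGu
  -- the numerator of the polar part vanishes at the singular point
  set Q : ℂ → 𝔸 := fun x => A j s₀ - G x * L j * Ring.inverse (G x) with hQ
  have hQa : AnalyticAt ℂ Q (b s₀ j) := analyticAt_const.sub ((hG.mul analyticAt_const).mul hGi)
  have hQ0 : Q (b s₀ j) = 0 := by
    simp only [hQ]
    rw [← hAG, mul_assoc, Ring.mul_inverse_cancel _ hGu, mul_one, sub_self]
  have hds : AnalyticAt ℂ (dslope Q (b s₀ j)) (b s₀ j) := by
    obtain ⟨U, hU, hUd⟩ := (Complex.analyticAt_iff_eventually_differentiableAt.1 hQa).exists_mem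
    have hUd' : DifferentiableOn ℂ Q U := fun y hy => (hUd y hy).differentiableWithinAt
    exact ((Complex.differentiableOn_dslope hU).2 hUd').analyticAt hU
  refine ⟨fun x => G' x * Ring.inverse (G x) + b' j • dslope Q (b s₀ j) x +
    ∑ i ∈ Finset.univ.erase j, ((b' i * (x - b s₀ i)⁻¹) • A i s₀ -
      (f i * branchLog θ (x - b s₀ i)) • (1 : 𝔸)), ?_, ?_⟩
  · refine ((hG'.mul hGi).add (hds.const_smul (c := b' j))).add ?_
    refine Finset.analyticAt_fun_sum _ fun i hi => ?_
    have hij : i ≠ j := Finset.ne_of_mem_erase hi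
    have hc := h.cutsDisjoint.self_of_nhds
    exact ((analyticAt_const.mul (analyticAt_inv_sub (sub_ne_zero_of_cutsDisjoint hc hij))).smul
      analyticAt_const).sub ((analyticAt_const.mul (analyticAt_branchLog_sub hc hij)).smul
      analyticAt_const)
  · filter_upwards [hder] with x hx hxD
    have hxj : x ≠ b s₀ j := sub_ne_zero.1 (sub_ne_zero_of_mem_cutPlane hxD j)
    rw [defect, (hx hxD).deriv, mul_assoc, Ring.mul_inverse_cancel _ (h.isUnit x hxD), mul_one,
      ← Finset.add_sum_erase _ _ (Finset.mem_univ j), dslope_of_ne _ hxj, slope_def_module, hQ0,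
      sub_zero]
    simp only [hQ, smul_sub, smul_smul]
    abel

/-- The defect extends to an entire function. -/
lemma exists_entire_defect (h : IsScalarDeformation θ s₀ b b' A L φ f Λ ψ g Y) :
    ∃ F : ℂ → 𝔸, (∀ x, AnalyticAt ℂ F x) ∧
      ∀ x ∈ cutPlane θ (b s₀), F x = defect θ s₀ b b' A f Y x := by
  refine exists_entire_extension (dense_cutPlane θ (b s₀)) fun x => ?_
  obtain ⟨T, R, hT, hR, hE⟩ := h.exists_defect_linearODE
  by_cases hx : x ∈ cutPlane θ (b s₀)
  · refine ⟨_, ?_, Eventually.of_forall fun y _ => rfl⟩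
    have hd : DifferentiableOn ℂ (defect θ s₀ b b' A f Y) (cutPlane θ (b s₀)) := fun y hy =>
      (hE y hy).differentiableAt.differentiableWithinAt
    exact hd.analyticAt ((isOpen_cutPlane θ (b s₀)).mem_nhds hx)
  · rw [mem_cutPlane_iff, not_forall] at hx
    obtain ⟨j, hj⟩ := hx
    obtain ⟨e, he, hue⟩ := h.exists_defect_continuation_at_pole j
    rw [Complex.mem_slitPlane_iff, not_or, not_lt, not_not] at hj
    rcases hj.1.lt_or_eq with hlt | heq
    · exact exists_continuation_across_cut h.cutsDisjoint.self_of_nhds hT hR hE j he hue hj.2 hlt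
    · have h0 : rot θ * (x - b s₀ j) = 0 := Complex.ext heq hj.2
      have hxj : x = b s₀ j :=
        sub_eq_zero.1 ((mul_eq_zero.1 h0).resolve_left (rot_ne_zero θ))
      subst hxj
      exact ⟨e, he, hue⟩

/-- The scalar parts of the exponents satisfy the infinitesimal Fuchs relation, and the defect
vanishes. -/
lemma smul_one_eq_and_defect_eq_zero (h : IsScalarDeformation θ s₀ b b' A L φ f Λ ψ g Y) :
    g • (1 : 𝔸) = (∑ i, f i) • (1 : 𝔸) ∧
      ∀ x ∈ cutPlane θ (b s₀), defect θ s₀ b b' A f Y x = 0 := by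
  obtain ⟨F, hF, hFE⟩ := h.exists_entire_defect
  obtain ⟨J, hJ, hJ0, R₀, hR₀, hJd⟩ := h.exists_hasDerivAt_near_infty
  obtain ⟨R₁, hR₁⟩ := (finite_range fun j => (rot θ * b s₀ j).re).bddAbove
  obtain ⟨ρ, hρ, hJρ⟩ := Metric.eventually_nhds_iff.1 hJ.eventually_analyticAt
  set R : ℝ := max (max R₀ R₁) ρ⁻¹ with hR
  have hx0 : ∀ x, R < (rot θ * x).re → x ≠ 0 := by
    rintro x hx rfl
    have : R₀ ≤ R := (le_max_left _ _).trans (le_max_left _ _)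
    simp only [mul_zero, Complex.zero_re] at hx
    linarith
  have hD : ∀ x, R < (rot θ * x).re → x ∈ cutPlane θ (b s₀) := fun x hx =>
    mem_cutPlane_of_re_lt fun j => ((hR₁ (mem_range_self j)).trans
      ((le_max_right _ _).trans (le_max_left _ _))).trans_lt hx
  have hJx : ∀ x, R < (rot θ * x).re → AnalyticAt ℂ J x⁻¹ := by
    intro x hx
    apply hJρ
    have : ρ⁻¹ < ‖x‖ := by
      refine ((le_max_right _ _).trans_lt hx).trans_le ((Complex.re_le_norm _).trans ?_)
      rw [norm_mul, norm_rot, one_mul]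
    rw [dist_zero_right, norm_inv]
    exact inv_lt_of_inv_lt₀ hρ this
  have hFx : ∀ x, R < (rot θ * x).re → F x = J x⁻¹ + (g * branchLog θ x) • (1 : 𝔸) +
      ∑ i, ((b' i * (x - b s₀ i)⁻¹) • A i s₀ -
        (f i * branchLog θ (x - b s₀ i)) • (1 : 𝔸)) := by
    intro x hx
    have hxD := hD x hx
    rw [hFE x hxD, defect, (hJd x (((le_max_left _ _).trans (le_max_left _ _)).trans_lt hx)).deriv,
      mul_assoc, Ring.mul_inverse_cancel _ (h.isUnit x hxD), mul_one]
  -- `x F'(x)` is entire, and on a half plane it is a holomorphic function `T` of `1/x`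
  set T : ℂ → 𝔸 := fun w => -(w • deriv J w) + g • (1 : 𝔸) +
    ∑ i, (-(b' i * (w * ((1 - b s₀ i * w)⁻¹) ^ 2)) • A i s₀ -
      (f i * (1 - b s₀ i * w)⁻¹) • (1 : 𝔸)) with hTdef
  have hT : AnalyticAt ℂ T 0 := by
    refine ((analyticAt_id.smul hJ.deriv).neg.add analyticAt_const).add
      (Finset.analyticAt_fun_sum _ fun i _ => ?_)
    have : AnalyticAt ℂ (fun w => (1 - b s₀ i * w)⁻¹) 0 :=
      (analyticAt_const.sub (analyticAt_const.mul analyticAt_id)).inv (by simp)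
    exact ((analyticAt_const.mul (analyticAt_id.mul (this.pow 2))).neg.smul analyticAt_const).sub
      ((analyticAt_const.mul this).smul analyticAt_const)
  have hT0 : T 0 = g • (1 : 𝔸) - (∑ i, f i) • (1 : 𝔸) := by
    simp [hTdef, Finset.sum_smul, sub_eq_add_neg]
  have hPT : ∀ x, R < (rot θ * x).re → x • deriv F x = T x⁻¹ := by
    intro x hx
    have hxne := hx0 x hx
    have hopen : ∀ᶠ y in 𝓝 x, R < (rot θ * y).re :=
      ContinuousAt.eventually_lt continuousAt_const
        (Complex.continuous_re.continuousAt.comp (by fun_prop)) hx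
    have hmem : rot θ * x ∈ Complex.slitPlane :=
      Or.inl (hR₀.trans (((le_max_left _ _).trans (le_max_left _ _)).trans_lt hx))
    have h1 := (hJx x hx).differentiableAt.hasDerivAt.scomp x (hasDerivAt_inv hxne)
    have h2 := ((hasDerivAt_branchLog hmem).const_mul g).smul_const (1 : 𝔸)
    have h3 : HasDerivAt (fun y => ∑ i, ((b' i * (y - b s₀ i)⁻¹) • A i s₀ -
        (f i * branchLog θ (y - b s₀ i)) • (1 : 𝔸))) _ x :=
      HasDerivAt.fun_sum fun i _ =>
        (((hasDerivAt_inv_sub (sub_ne_zero_of_mem_cutPlane (hD x hx) i)).const_mul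
          (b' i)).smul_const (A i s₀)).sub
        (((hasDerivAt_branchLog_sub (hD x hx) i).const_mul (f i)).smul_const (1 : 𝔸))
    have h4 := ((h1.add h2).add h3).congr_of_eventuallyEq (f₁ := F)
      (hopen.mono fun y hy => hFx y hy)
    rw [h4.deriv]
    simp only [hTdef, smul_add, Finset.smul_sum, smul_sub, smul_smul]
    congr 1
    · congr 1
      · rw [← neg_smul]
        congr 1
        field_simp
      · congr 1
        field_simp
    · refine Finset.sum_congr rfl fun i _ => ?_
      have hi := sub_ne_zero_of_mem_cutPlane (hD x hx) i
      have hi' : 1 - b s₀ i * x⁻¹ = (x - b s₀ i) * x⁻¹ := by field_simp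
      rw [hi']
      congr 2 <;> field_simp
  have hconst := entire_eq_const_of_analyticAt_inv_halfPlane (P := fun x => x • deriv F x)
    (fun x => analyticAt_id.smul (hF x).deriv) hT hPT
  have hT00 : T 0 = 0 := by
    have := hconst 0
    simpa using this.symm
  have hg : g • (1 : 𝔸) = (∑ i, f i) • (1 : 𝔸) := sub_eq_zero.1 (hT0 ▸ hT00)
  refine ⟨hg, fun x hx => ?_⟩
  have hF' : ∀ y, y ≠ 0 → deriv F y = 0 := fun y hy =>
    (smul_eq_zero.1 ((hconst y).trans hT00)).resolve_left hy
  have hF'0 : ∀ y, deriv F y = 0 := by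
    have hc : Continuous (deriv F) := continuous_iff_continuousAt.2 fun y =>
      (hF y).deriv.continuousAt
    have := Continuous.ext_on (dense_compl_singleton (0 : ℂ)) hc continuous_const
      (fun y hy => hF' y hy)
    exact fun y => congrFun this y
  have hFc : ∀ y z, F y = F z := is_const_of_deriv_eq_zero
    (fun y => (hF y).differentiableAt) hF'0
  -- the constant is the limit along a ray, where the logarithms cancel
  have hlim : Tendsto (fun t : ℝ => F (t * (rot θ)⁻¹)) atTop (𝓝 0) := by
    have hinf : Tendsto (fun t : ℝ => (t * (rot θ)⁻¹ : ℂ)) atTop (Bornology.cobounded ℂ) := by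
      rw [← tendsto_norm_atTop_iff_cobounded]
      refine tendsto_norm_atTop_atTop.congr fun t => ?_
      simp [norm_rot]
    have h1 : Tendsto (fun t : ℝ => J (t * (rot θ)⁻¹ : ℂ)⁻¹) atTop (𝓝 0) := by
      have := hJ.continuousAt.tendsto.comp (tendsto_inv₀_cobounded.comp hinf)
      rwa [hJ0] at this
    have h2 : ∀ i, Tendsto (fun t : ℝ => (b' i * (t * (rot θ)⁻¹ - b s₀ i : ℂ)⁻¹) • A i s₀ -
        (f i * (branchLog θ (t * (rot θ)⁻¹ - b s₀ i) - branchLog θ (t * (rot θ)⁻¹))) •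
          (1 : 𝔸)) atTop (𝓝 0) := by
      intro i
      have h3 : Tendsto (fun t : ℝ => (t * (rot θ)⁻¹ - b s₀ i : ℂ)⁻¹) atTop (𝓝 0) :=
        tendsto_inv₀_cobounded.comp ((tendsto_sub_const_cobounded (b s₀ i)).comp hinf)
      have h4 := (h3.const_mul (b' i)).smul_const (A i s₀)
      have h5 := ((tendsto_branchLog_sub_branchLog θ (b s₀ i)).const_mul (f i)).smul_const (1 : 𝔸)
      simpa using h4.sub h5
    have h6 := h1.add (tendsto_finsetSum Finset.univ fun i _ => h2 i)
    simp only [Finset.sum_const_zero, add_zero] at h6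
    refine h6.congr' ?_
    filter_upwards [eventually_gt_atTop R] with t ht
    have hre : R < (rot θ * (t * (rot θ)⁻¹)).re := by
      have : rot θ * (t * (rot θ)⁻¹) = t := by
        have := rot_ne_zero θ
        field_simp
      rwa [this, Complex.ofReal_re]
    rw [hFx _ hre, mul_comm g, mul_smul, hg]
    simp only [mul_sub, sub_smul, Finset.sum_sub_distrib, Finset.sum_smul, Finset.smul_sum,
      smul_smul, mul_comm (branchLog θ (t * (rot θ)⁻¹))]
    abel
  have hF0 : F x = 0 := tendsto_nhds_unique
    (tendsto_const_nhds.congr fun t : ℝ => hFc x (t * (rot θ)⁻¹)) hlim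
  rw [← hFE x hx, hF0]

/-- The deformation equation, along a curve of parameters. -/
lemma hasDerivAt_param (h : IsScalarDeformation θ s₀ b b' A L φ f Λ ψ g Y) {x : ℂ}
    (hx : x ∈ cutPlane θ (b s₀)) :
    HasDerivAt (fun s => Y s x) ((∑ i, (-((b' i * (x - b s₀ i)⁻¹) • A i s₀) +
      (f i * branchLog θ (x - b s₀ i)) • (1 : 𝔸))) * Y s₀ x) s₀ := by
  choose A' hA using h.exists_hasDerivAt_residue
  obtain ⟨V, hV, -⟩ := h.exists_variation hA hx
  refine hV.self_of_nhds.congr_deriv ?_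
  have h0 := h.smul_one_eq_and_defect_eq_zero.2 x hx
  rw [defect, hV.self_of_nhds.deriv, add_eq_zero_iff_eq_neg] at h0
  have h1 := congrArg (· * Y s₀ x) h0
  simp only [mul_assoc, Ring.inverse_mul_cancel _ (h.isUnit x hx), mul_one] at h1
  rw [h1, ← Finset.sum_neg_distrib]
  congr 1
  exact Finset.sum_congr rfl fun i _ => by abel

end IsScalarDeformation

/-! ### Matrices -/

section Matrices

open scoped Matrix.Norms.Operator

variable {n N : ℕ}

/-- A matrix function with analytic entries is analytic for the operator norm. -/
lemma analyticAt_matrix {E : Type*} [NormedAddCommGroup E] [NormedSpace ℂ E]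
    {G : E → Matrix (Fin N) (Fin N) ℂ} {x : E}
    (h : ∀ p q, AnalyticAt ℂ (fun z => G z p q) x) : AnalyticAt ℂ G x := by
  have h1 : G = fun z => ∑ p, ∑ q, G z p q • Matrix.single p q (1 : ℂ) := by
    funext z
    conv_lhs => rw [Matrix.matrix_eq_sum_single (G z)]
    simp [Matrix.smul_single]
  rw [h1]
  exact Finset.analyticAt_fun_sum _ fun p _ => Finset.analyticAt_fun_sum _ fun q _ =>
    (h p q).smul analyticAt_const

/-- A matrix function whose derivative is scalar changes only by a scalar matrix. -/
lemma exists_scalar_of_hasDerivAt {F : ℂ → Matrix (Fin N) (Fin N) ℂ} {f : ℂ → ℂ} {s₀ : ℂ}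
    (h : ∀ᶠ s in 𝓝 s₀, HasDerivAt F (f s • (1 : Matrix (Fin N) (Fin N) ℂ)) s) :
    ∃ φ : ℂ → ℂ, φ s₀ = 0 ∧ HasDerivAt φ (f s₀) s₀ ∧
      ∀ᶠ s in 𝓝 s₀, F s = F s₀ + φ s • (1 : Matrix (Fin N) (Fin N) ℂ) := by
  obtain ⟨r, hr, hF⟩ := Metric.eventually_nhds_iff_ball.1 h
  have hent : ∀ s ∈ Metric.ball s₀ r, ∀ p q,
      HasDerivAt (fun s => F s p q) (f s * (1 : Matrix (Fin N) (Fin N) ℂ) p q) s := by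
    intro s hs p q
    have := hasDerivAt_pi.1 (hasDerivAt_pi.1 (hF s hs) p) q
    simpa using this
  rcases isEmpty_or_nonempty (Fin N) with hN | ⟨⟨i⟩⟩
  · refine ⟨fun s => f s₀ * (s - s₀), by simp, ?_, Eventually.of_forall fun s =>
      Subsingleton.elim _ _⟩
    simpa using ((hasDerivAt_id s₀).sub_const s₀).const_mul (f s₀)
  have hii : ∀ s ∈ Metric.ball s₀ r, HasDerivAt (fun s => F s i i - F s₀ i i) (f s) s := by
    intro s hs
    simpa using (hent s hs i i).sub_const (F s₀ i i)
  refine ⟨fun s => F s i i - F s₀ i i, by simp, hii s₀ (Metric.mem_ball_self hr), ?_⟩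
  filter_upwards [Metric.ball_mem_nhds s₀ hr] with s hs
  ext p q
  have hconst := (convex_ball s₀ r).is_const_of_fderivWithin_eq_zero (𝕜 := ℂ)
    (f := fun s => F s p q - (F s i i - F s₀ i i) * (1 : Matrix (Fin N) (Fin N) ℂ) p q)
    (fun y hy => ((hent y hy p q).sub
      ((hii y hy).mul_const _)).differentiableAt.differentiableWithinAt)
    (fun y hy => by
      have h1 := (hent y hy p q).sub ((hii y hy).mul_const
        ((1 : Matrix (Fin N) (Fin N) ℂ) p q))
      rw [sub_self] at h1
      rw [fderivWithin_of_isOpen Metric.isOpen_ball hy]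
      exact h1.hasFDerivAt.fderiv.trans (by simp)) hs (Metric.mem_ball_self hr)
  simp only [sub_self, zero_mul, sub_zero] at hconst
  rw [Matrix.add_apply, Matrix.smul_apply, smul_eq_mul, ← hconst]
  ring

/-- Along a coordinate line of the parameter space, the hypotheses of the theorem give a scalar
deformation in the Banach algebra of matrices. -/
lemma exists_isScalarDeformation_update {θ : ℝ} {U : Set (Fin n → ℂ)} (hU : IsOpen U)
    (hcuts : ∀ a ∈ U, CutsDisjoint θ a)
    {A L : Fin n → (Fin n → ℂ) → Matrix (Fin N) (Fin N) ℂ}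
    {Linf : (Fin n → ℂ) → Matrix (Fin N) (Fin N) ℂ} {f : Fin n → Fin n → (Fin n → ℂ) → ℂ}
    {g : (Fin n → ℂ) → ℂ} {Y : (Fin n → ℂ) → ℂ → Matrix (Fin N) (Fin N) ℂ}
    (hY : ∀ a ∈ U, IsFundamentalSolution θ a (fun k => A k a) (Y a))
    (hloc : ∀ a ∈ U, ∀ j, HasLocalExpansionAt θ Y j (L j) a)
    (hinf : ∀ a ∈ U, HasExpansionAtInfty θ Y Linf a) {k : Fin n}
    (hL : ∀ a ∈ U, ∀ j, HasPartialDerivAt k (L j)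
      (f j k a • (1 : Matrix (Fin N) (Fin N) ℂ)) a)
    (hLinf : ∀ a ∈ U, HasPartialDerivAt k Linf (g a • (1 : Matrix (Fin N) (Fin N) ℂ)) a)
    {a : Fin n → ℂ} (ha : a ∈ U) :
    ∃ φ ψ, IsScalarDeformation θ (a k) (fun s => Function.update a k s) (Pi.single k 1)
      (fun j s => A j (Function.update a k s)) (fun j => L j a) φ (fun j => f j k a) (-Linf a) ψ
      (-g a) (fun s => Y (Function.update a k s)) := by
  have hupd : Continuous fun s : ℂ => Function.update a k s :=
    continuous_const.update k continuous_id
  have hupd₀ : Tendsto (fun s : ℂ => Function.update a k s) (𝓝 (a k)) (𝓝 a) := by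
    simpa using hupd.tendsto (a k)
  have hsU : ∀ᶠ s in 𝓝 (a k), Function.update a k s ∈ U := hupd₀.eventually (hU.mem_nhds ha)
  have hline : ∀ {F : (Fin n → ℂ) → Matrix (Fin N) (Fin N) ℂ} {h : (Fin n → ℂ) → ℂ},
      (∀ a ∈ U, HasPartialDerivAt k F (h a • (1 : Matrix (Fin N) (Fin N) ℂ)) a) →
      ∃ φ : ℂ → ℂ, φ (a k) = 0 ∧ HasDerivAt φ (h a) (a k) ∧ ∀ᶠ s in 𝓝 (a k),
        F (Function.update a k s) = F a + φ s • (1 : Matrix (Fin N) (Fin N) ℂ) := by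
    intro F h hF
    have h1 := exists_scalar_of_hasDerivAt (F := fun s => F (Function.update a k s))
      (f := fun s => h (Function.update a k s)) (s₀ := a k) (by
        filter_upwards [hsU] with s hs
        have := hF _ hs
        simpa [HasPartialDerivAt] using this)
    simpa using h1
  have hana : ∀ x₀ : ℂ,
      AnalyticAt ℂ (fun z : ℂ × ℂ => (Function.update a k z.1, z.2)) (a k, x₀) := by
    intro x₀
    have h1 : (fun z : ℂ × ℂ => Function.update a k z.1) =
        fun z => a + (z.1 - a k) • (Pi.single k (1 : ℂ) : Fin n → ℂ) := by
      funext z i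
      by_cases hi : i = k
      · subst hi; simp
      · simp [hi]
    have h2 : AnalyticAt ℂ (fun z : ℂ × ℂ => Function.update a k z.1) (a k, x₀) := by
      rw [h1]
      exact analyticAt_const.add ((analyticAt_fst.sub analyticAt_const).smul analyticAt_const)
    exact h2.prod analyticAt_snd
  have hcont : ∀ x₀ : ℂ, Tendsto (fun z : ℂ × ℂ => (Function.update a k z.1, z.2)) (𝓝 (a k, x₀))
      (𝓝 (a, x₀)) := by
    intro x₀
    simpa using (hana x₀).continuousAt.tendsto
  choose φ hφ0 hφd hφ using fun j => hline (F := L j) (h := f j k) fun a ha => hL a ha j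
  obtain ⟨ψ, hψ0, hψd, hψ⟩ := hline hLinf
  refine ⟨φ, fun s => -ψ s, ?_⟩
  constructor
  · exact fun j => hasDerivAt_pi.1 (hasDerivAt_update a k (a k)) j
  · exact hφ0
  · exact hφd
  · simp [hψ0]
  · exact hψd.neg
  · exact hsU.mono fun s hs => hcuts _ hs
  · exact hsU.mono fun s hs => (hY _ hs).hasDerivAt
  · intro x hx
    simp only [Function.update_eq_self] at hx ⊢
    exact (hY a ha).isUnit x hx
  · intro j
    obtain ⟨G, hG, hGu, hYG⟩ := hloc a ha j
    refine ⟨fun z => G (Function.update a k z.1, z.2), ?_, by simpa using hGu, ?_⟩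
    · have h1 : AnalyticAt ℂ G (Function.update a k (a k), a j) := by
        simpa using analyticAt_matrix hG
      simpa using h1.fun_comp (f := fun z : ℂ × ℂ => (Function.update a k z.1, z.2)) (hana (a j))
    · simp only [Function.update_eq_self]
      have hφ' : ∀ᶠ z : ℂ × ℂ in 𝓝 (a k, a j), L j (Function.update a k z.1) =
          L j a + φ j z.1 • (1 : Matrix (Fin N) (Fin N) ℂ) :=
        (continuous_fst.tendsto (a k, a j)).eventually (hφ j)
      filter_upwards [(hcont (a j)).eventually hYG, hφ'] with z hz hz' hzD
      rw [hz hzD, matPow, hz']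
      rfl
  · obtain ⟨H, hH, hH1, R, hYH⟩ := hinf a ha
    refine ⟨fun z => H (Function.update a k z.1, z.2), ?_, ?_, R, ?_⟩
    · have h1 : AnalyticAt ℂ H (Function.update a k (a k), 0) := by
        simpa using analyticAt_matrix hH
      exact h1.fun_comp (f := fun z : ℂ × ℂ => (Function.update a k z.1, z.2)) (hana 0)
    · exact hupd₀.eventually hH1
    · filter_upwards [hupd₀.eventually hYH, hψ] with s hs hs' x hx
      rw [hs x hx, matPow, hs', neg_add, ← neg_smul]
      rfl

end Matrices

end MonodromyEvolving

open scoped Matrix.Norms.Operator in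
theorem mainTheorem1 {n N : ℕ} (θ : ℝ) (U : Set (Fin n → ℂ)) (hU : IsOpen U)
    (hcuts : ∀ a ∈ U, MonodromyEvolving.CutsDisjoint θ a)
    (A L : Fin n → (Fin n → ℂ) → Matrix (Fin N) (Fin N) ℂ)
    (Linf : (Fin n → ℂ) → Matrix (Fin N) (Fin N) ℂ)
    (f : Fin n → Fin n → (Fin n → ℂ) → ℂ)
    (Y : (Fin n → ℂ) → ℂ → Matrix (Fin N) (Fin N) ℂ)
    (hY : ∀ a ∈ U, MonodromyEvolving.IsFundamentalSolution θ a (fun k => A k a) (Y a))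
    (hloc : ∀ a ∈ U, ∀ j, MonodromyEvolving.HasLocalExpansionAt θ Y j (L j) a)
    (hinf : ∀ a ∈ U, MonodromyEvolving.HasExpansionAtInfty θ Y Linf a)
    (hL : ∀ a ∈ U, ∀ j k, MonodromyEvolving.HasPartialDerivAt k (L j)
      (f j k a • (1 : Matrix (Fin N) (Fin N) ℂ)) a)
    (hLinf : ∀ a ∈ U, ∀ k, ∃ g : ℂ, MonodromyEvolving.HasPartialDerivAt k Linf
      (g • (1 : Matrix (Fin N) (Fin N) ℂ)) a) :
    ∀ a ∈ U, ∀ k,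
      MonodromyEvolving.HasPartialDerivAt k Linf
        (-∑ j, f j k a • (1 : Matrix (Fin N) (Fin N) ℂ)) a ∧
      ∀ x ∈ MonodromyEvolving.cutPlane θ a,
        MonodromyEvolving.HasPartialDerivAt k (fun b => Y b x)
          ((-((x - a k)⁻¹ • A k a) +
            ∑ j, (f j k a * MonodromyEvolving.branchLog θ (x - a j)) •
              (1 : Matrix (Fin N) (Fin N) ℂ)) * Y a x) a := by
  intro a ha k
  choose! g hg using fun a ha => hLinf a ha k
  obtain ⟨φ, ψ, h⟩ := MonodromyEvolving.exists_isScalarDeformation_update hU hcuts hY hloc hinf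
    (fun a ha j => hL a ha j k) hg ha
  refine ⟨?_, fun x hx => ?_⟩
  · have h1 := h.smul_one_eq_and_defect_eq_zero.1
    rw [neg_smul, neg_eq_iff_eq_neg, Finset.sum_smul] at h1
    rw [← h1]
    exact hg a ha
  · have h1 := h.hasDerivAt_param (x := x) (by simpa using hx)
    simp only [Function.update_eq_self, Finset.sum_add_distrib, Finset.sum_neg_distrib] at h1
    refine h1.congr_deriv ?_
    rw [Finset.sum_eq_single k (by intro i _ hi; simp [hi]) (by simp), Pi.single_eq_same, one_mul]
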